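/- Setting. Let $\mathcal G=(\mathcal V,\mathcal E)$ be a finite connected undirected simple graph with $N=|\mathcal V|$ vertices and $E=|\mathcal E|$ edges, and let $\mathcal A$ be the set of its $2E$ arcs (each edge $\{i,j\}$ gives the arcs $(i,j)$ and $(j,i)$); $\mathcal N_i$ is the set of neighbours of $i$. For each $i\in\mathcal V$ let $g_i:\mathbb R^M\to\mathbb R$ be convex and differentiable, and let $h_i:\mathbb R^M\to\mathbb R\cup\{\infty\}$ be convex and lower semicontinuous. For $x=(x_i)_{i\in\mathcal V}\in\mathbb R^{MN}$ put $g(x)=\sum_i g_i(x_i)$, $h(x)=\sum_i h_i(x_i)$, $f=g+h$, $\mathrm{dom}(h)=\prod_i\mathrm{dom}(h_i)\subseteq\mathbb R^{MN}$ and $G(x)=[\nabla g_1(x_1);\dots;\nabla g_N(x_N)]$. Assume: 1. the problem $\min_{y\in\mathbb R^M}\sum_i(g_i(y)+h_i(y))$ has an optimal solution, and the Slater condition $\bigcap_i \mathrm{ri}(\mathrm{dom}(h_i))\neq\emptyset$ holds; 2. for each $i$ there is given $P_i>0$ with $\|\nabla g_i(y)-\nabla g_i(v)\|\le P_i\|y-v\|$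 for all $y,v\in\mathrm{dom}(h_i)$. Let $A_1,A_2\in\mathbb R^{2EM\times NM}$ be the block matrices whose block in row $(i,j)\in\mathcal A$ and column $k\in\mathcal V$ is $I_M$ if $k=i$ (for $A_1$), resp. if $k=j$ (for $A_2$), and $0$ otherwise; $A=[A_1;A_2]$, $B=[-I_{2EM};-I_{2EM}]$, $M_+=A_1^T+A_2^T$. Consider $$(\mathrm P)\qquad \min_{x,z} f(x)\quad\text{s.t. } Ax+Bz=0 .$$ A primal-dual optimal solution of (P) is a triple $(x^*,z^*,\lambda^*)$ such that $(x^*,z^*)$ is optimal for (P) and $(x^*,z^*,\lambda^*)$ is a saddle point of $L_0(x,z;\lambda)=f(x)+\langle\lambda,Ax+Bz\rangle$ (minimized over $x\in\mathrm{dom}(h)$ and $z$, maximized over $\lambda$). Let $\rho_{ij}>0$ for $(i,j)\in\mathcal A$, $\omega_i\ge0$ for $i\in\mathcal V$, $\Xi=\mathrm{diag}(\rho_{ij})_{(i,j)\in\mathcal A}$, $\Gamma=\mathrm{blkdg}[\Xi\otimes I_M,\Xi\otimes I_M]$, $\Omega=\mathrm{diag}(\omega_i)\otimes I_M$, $\widetilde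 P=\mathrm{diag}(P_i)\otimes I_M$, $\beta_i=\sum_{j\in\mathcal N_i}(\rho_{ij}+\rho_{ji})+\omega_i$, $\Upsilon=\mathrm{diag}(\beta_i)\otimes I_M$, and let $W\in\mathbb R^{N\times N}$ have entries $W[i,j]=(\rho_{ij}+\rho_{ji})/\beta_i$ if $(i,j)\in\mathcal A$, $W[i,i]=\omega_i/\beta_i$, and $0$ otherwise (with the convention $0/0=0$, needed only when $N=1$ and $\omega_i=0$). Write $\|v\|_Q^2=v^TQv$. PGC algorithm. Start from $(x^0,z^0,\lambda^0)$ with $B^T\lambda^0=0$ and $z^0=\tfrac12M_+^Tx^0$, and for $r\ge0$ let $$x^{r+1}\in\arg\min_x\Big\{\langle G(x^r),x-x^r\rangle+h(x)+\langle\lambda^r,Ax+Bz^r\rangle+\tfrac12\|Ax+Bz^r\|_\Gamma^2+\tfrac12\|x-x^r\|_\Omega^2\Big\},$$ $$z^{r+1}\in\arg\min_z\tfrac12\|Ax^{r+1}+Bz+\Gamma^{-1}\lambda^r\|_\Gamma^2,\qquad \lambda^{r+1}=\lambda^r+\Gamma(Ax^{r+1}+Bz^{r+1}).$$ Theorem.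 One has $2\Omega+M_+(\Xi\otimes I_M)M_+^T=\Upsilon(W\otimes I_M)+\Upsilon$, and for every sequence $(x^r,z^r,\lambda^r)_{r\ge0}$ generated by PGC: (a) If $2\Omega+M_+(\Xi\otimes I_M)M_+^T\succ\widetilde P$, then $(x^r,z^r,\lambda^r)$ converges to a primal-dual optimal solution of (P). (b) Suppose that $\mathrm{dom}(h)$ is bounded, $x^0\in\mathrm{dom}(h)$, and $2\Omega+M_+(\Xi\otimes I_M)M_+^T\succ2\widetilde P$. Let $\bar x^r=\frac1r\sum_{t=1}^r x^t$, $\bar z^r=\frac1r\sum_{t=1}^r z^t$, and $$d_x=\sup_{\hat x,\tilde x\in\mathrm{dom}(h)}\|\hat x-\tilde x\|,\qquad d_z=\sup_{\hat x,\tilde x\in\mathrm{dom}(h)}\sqrt{\sum_{(i,j)\in\mathcal A}2\rho_{ij}\|\hat x_i-\tilde x_j\|^2},\qquad d_\lambda(\rho)=\sup_{\|\lambda\|\le\rho}\|\lambda-\lambda^0\|_{\Gamma^{-1}}.$$ Then for every optimal solution $(x^*,z^*)$ of (P), every $\rho>0$ and every integer $r\ge1$, $\bar x^r\in\mathrm{dom}(h)$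 and $$f(\bar x^r)-f(x^*)+\rho\|A\bar x^r+B\bar z^r\|\le\frac1{2r}\Big(d_z^2+d_\lambda(\rho)^2+\max_i\omega_i\,d_x^2\Big).$$ -/

import Mathlib

open scoped Matrix Kronecker

noncomputable section

namespace PGC

variable {V : Type*} [Fintype V] [DecidableEq V] (G : SimpleGraph V) [DecidableRel G.Adj] (M : ℕ)

/-! ### Stacked vectors

`V` is the set of agents and `G.Dart` the set of arcs of the companion symmetric directed graph
(each edge gives two arcs).  Vectors of `ℝ^(MN)`, `ℝ^(2EM)`, `ℝ^(4EM)` are coordinate functions;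
their Euclidean norm is `euclNorm`. -/

/-- Stacked primal vectors `x = (x_i)`. -/
abbrev XVec (V : Type*) (M : ℕ) := V × Fin M → ℝ

/-- Stacked link vectors `z = (z_ij)`, one block for each arc. -/
abbrev ZVec (M : ℕ) := G.Dart × Fin M → ℝ

/-- Dual vectors, one coordinate for each row of the constraint `A x + B z = 0`. -/
abbrev LVec (M : ℕ) := (G.Dart × Fin M) ⊕ (G.Dart × Fin M) → ℝ

/-- The `i`-th block `x_i ∈ ℝ^M` of a stacked vector. -/
def blk {M : ℕ} (x : XVec V M) (i : V) : EuclideanSpace ℝ (Fin M) :=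
  WithLp.toLp 2 (fun k => x (i, k))

/-- The Euclidean norm of a coordinate vector. -/
def euclNorm {ι : Type*} [Fintype ι] (v : ι → ℝ) : ℝ := ‖WithLp.toLp 2 v‖

/-- The weighted square `‖v‖_Q ^ 2 = vᵀ Q v`. -/
def wsq {ι : Type*} [Fintype ι] (Q : Matrix ι ι ℝ) (v : ι → ℝ) : ℝ := v ⬝ᵥ (Q *ᵥ v)

/-! ### Graph matrices -/

/-- Block `(q, i)` is `I_M` if `i` is the tail of the arc `q`, and `0` otherwise. -/
def A₁ : Matrix (G.Dart × Fin M) (V × Fin M) ℝ :=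
  (Matrix.of fun (e : G.Dart) (i : V) => if e.fst = i then (1 : ℝ) else 0) ⊗ₖ
    (1 : Matrix (Fin M) (Fin M) ℝ)

/-- Block `(q, j)` is `I_M` if `j` is the head of the arc `q`, and `0` otherwise. -/
def A₂ : Matrix (G.Dart × Fin M) (V × Fin M) ℝ :=
  (Matrix.of fun (e : G.Dart) (j : V) => if e.snd = j then (1 : ℝ) else 0) ⊗ₖ
    (1 : Matrix (Fin M) (Fin M) ℝ)

/-- `A = [A₁; A₂]`. -/
def A : Matrix ((G.Dart × Fin M) ⊕ (G.Dart × Fin M)) (V × Fin M) ℝ :=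
  Matrix.fromRows (A₁ G M) (A₂ G M)

/-- `B = [-I; -I]`. -/
def B : Matrix ((G.Dart × Fin M) ⊕ (G.Dart × Fin M)) (G.Dart × Fin M) ℝ :=
  Matrix.fromRows (-1) (-1)

/-- `M₊ = A₁ᵀ + A₂ᵀ`. -/
def Mplus : Matrix (V × Fin M) (G.Dart × Fin M) ℝ := (A₁ G M)ᵀ + (A₂ G M)ᵀ

/-- `Ξ`, the diagonal matrix of the penalty constants `ρ_ij`, one for each arc `(i, j)`. -/
def Xi (rho : V → V → ℝ) : Matrix G.Dart G.Dart ℝ :=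
  Matrix.diagonal fun e => rho e.fst e.snd

/-- `Ξ ⊗ I_M`. -/
def XiI (rho : V → V → ℝ) : Matrix (G.Dart × Fin M) (G.Dart × Fin M) ℝ :=
  Xi G rho ⊗ₖ (1 : Matrix (Fin M) (Fin M) ℝ)

/-- `Γ = blkdg[Ξ ⊗ I_M, Ξ ⊗ I_M]`. -/
def Gam (rho : V → V → ℝ) :
    Matrix ((G.Dart × Fin M) ⊕ (G.Dart × Fin M)) ((G.Dart × Fin M) ⊕ (G.Dart × Fin M)) ℝ :=
  Matrix.fromBlocks (XiI G M rho) 0 0 (XiI G M rho)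

/-- `diag(c_1, …, c_N) ⊗ I_M`.  With `c = ω` this is `Ω`, with `c = P` it is `P̃`. -/
def diagI (c : V → ℝ) : Matrix (V × Fin M) (V × Fin M) ℝ :=
  Matrix.diagonal c ⊗ₖ (1 : Matrix (Fin M) (Fin M) ℝ)

/-- The stepsize parameters `β_i = 2 (∑_{j ∈ N_i} (ρ_ij + ρ_ji) / 2 + ω_i / 2)`. -/
def beta (rho : V → V → ℝ) (ω : V → ℝ) (i : V) : ℝ :=
  2 * (∑ j ∈ G.neighborFinset i, (rho i j + rho j i) / 2 + ω i / 2)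

/-- The weight matrix `W`. -/
def W (rho : V → V → ℝ) (ω : V → ℝ) : Matrix V V ℝ :=
  Matrix.of fun i j =>
    if G.Adj i j then (rho j i + rho i j) / beta G rho ω i
    else if i = j then ω i / beta G rho ω i
    else 0

/-- The stepsize matrix `Υ = diag(β_1, …, β_N) ⊗ I_M`. -/
def Ups (rho : V → V → ℝ) (ω : V → ℝ) : Matrix (V × Fin M) (V × Fin M) ℝ :=
  diagI M (beta G rho ω)

/-! ### The consensus problem -/

variable {M}

/-- Effective domain of an extended-real-valued function. -/
def edom {E : Type*} (φ : E → EReal) : Set E := {y | φ y ≠ ⊤}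

/-- Closed (lower semicontinuous) convex functions with values in `ℝ ∪ {∞}`. -/
structure IsClosedConvex {E : Type*} [AddCommGroup E] [Module ℝ E] [TopologicalSpace E]
    (φ : E → EReal) : Prop where
  ne_bot : ∀ y, φ y ≠ ⊥
  convex : ConvexOn ℝ (edom φ) (fun y => (φ y).toReal)
  lsc : LowerSemicontinuous φ

/-- Domain of the separable function `h(x) = ∑ h_i(x_i)` on `ℝ^(MN)`. -/
def domH (h : V → EuclideanSpace ℝ (Fin M) → EReal) : Set (XVec V M) :=
  {x | ∀ i, blk x i ∈ edom (h i)}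

/-- `f(x) = ∑ (g_i(x_i) + h_i(x_i))`, used only on `domH h`, where every `h_i(x_i)` is finite. -/
def f (g : V → EuclideanSpace ℝ (Fin M) → ℝ) (h : V → EuclideanSpace ℝ (Fin M) → EReal)
    (x : XVec V M) : ℝ :=
  ∑ i, (g i (blk x i) + (h i (blk x i)).toReal)

/-- `y` solves `min_y ∑ (g_i(y) + h_i(y))`. -/
def IsConsensusOptimal (g : V → EuclideanSpace ℝ (Fin M) → ℝ)
    (h : V → EuclideanSpace ℝ (Fin M) → EReal) (y : EuclideanSpace ℝ (Fin M)) : Prop :=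
  (∀ i, y ∈ edom (h i)) ∧
    ∀ y', (∀ i, y' ∈ edom (h i)) →
      ∑ i, (g i y + (h i y).toReal) ≤ ∑ i, (g i y' + (h i y').toReal)

/-- The standing assumptions on the objective: `g_i` convex and differentiable on `ℝ^M`, `h_i`
closed convex, a solution exists, Slater's condition (a common point of the relative interiors of
the domains), and `∇g_i` is `P_i`-Lipschitz on the domain. -/
structure Assumption (g : V → EuclideanSpace ℝ (Fin M) → ℝ)
    (h : V → EuclideanSpace ℝ (Fin M) → EReal) (P : V → ℝ) : Prop where
  g_convex : ∀ i, ConvexOn ℝ Set.univ (g i)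
  g_diff : ∀ i, Differentiable ℝ (g i)
  h_closed : ∀ i, IsClosedConvex (h i)
  exists_opt : ∃ y, IsConsensusOptimal g h y
  slater : ∃ y, ∀ i, y ∈ intrinsicInterior ℝ (edom (h i))
  P_pos : ∀ i, 0 < P i
  lipschitz : ∀ i, ∀ y ∈ edom (h i), ∀ v ∈ edom (h i),
    ‖gradient (g i) y - gradient (g i) v‖ ≤ P i * ‖y - v‖

/-- The constraint residual `A x + B z`. -/
def res (x : XVec V M) (z : ZVec G M) : LVec G M := A G M *ᵥ x + B G M *ᵥ z

/-- `(x, z)` is an optimal solution of `min f(x)` subject to `A x + B z = 0`. -/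
def IsPrimalOptimal (g : V → EuclideanSpace ℝ (Fin M) → ℝ)
    (h : V → EuclideanSpace ℝ (Fin M) → EReal) (x : XVec V M) (z : ZVec G M) : Prop :=
  x ∈ domH h ∧ res G x z = 0 ∧
    ∀ x' ∈ domH h, ∀ z' : ZVec G M, res G x' z' = 0 → f g h x ≤ f g h x'

/-- The Lagrangian `L₀(x, z; λ) = f(x) + ⟨λ, A x + B z⟩`. -/
def lagr (g : V → EuclideanSpace ℝ (Fin M) → ℝ) (h : V → EuclideanSpace ℝ (Fin M) → EReal)
    (x : XVec V M) (z : ZVec G M) (lam : LVec G M) : ℝ :=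
  f g h x + lam ⬝ᵥ res G x z

/-- `(x, z, λ)` is a primal-dual optimal solution: `(x, z)` is optimal for the constrained
problem and `(x, z, λ)` is a saddle point of the Lagrangian. -/
structure IsPrimalDualOptimal (g : V → EuclideanSpace ℝ (Fin M) → ℝ)
    (h : V → EuclideanSpace ℝ (Fin M) → EReal)
    (x : XVec V M) (z : ZVec G M) (lam : LVec G M) : Prop where
  primal : IsPrimalOptimal G g h x z
  saddle_left : ∀ lam' : LVec G M, lagr G g h x z lam' ≤ lagr G g h x z lam
  saddle_right : ∀ x' ∈ domH h, ∀ z' : ZVec G M, lagr G g h x z lam ≤ lagr G g h x' z' lam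

/-! ### The algorithm -/

/-- `G(x) = [∇g_1(x_1); …; ∇g_N(x_N)]`. -/
def gradStack (g : V → EuclideanSpace ℝ (Fin M) → ℝ) (x : XVec V M) : XVec V M :=
  fun p => gradient (g p.1) (blk x p.1) p.2

/-- The objective of the `x`-update at the current iterate `(xr, zr, lamr)`, on `domH h`. -/
def xObj (rho : V → V → ℝ) (ω : V → ℝ) (g : V → EuclideanSpace ℝ (Fin M) → ℝ)
    (h : V → EuclideanSpace ℝ (Fin M) → EReal)
    (xr : XVec V M) (zr : ZVec G M) (lamr : LVec G M) (x : XVec V M) : ℝ :=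
  gradStack g xr ⬝ᵥ (x - xr) + ∑ i, (h i (blk x i)).toReal + lamr ⬝ᵥ res G x zr
    + 1 / 2 * wsq (Gam G M rho) (res G x zr) + 1 / 2 * wsq (diagI M ω) (x - xr)

/-- The objective of the `z`-update. -/
def zObj (rho : V → V → ℝ) (x : XVec V M) (lamr : LVec G M) (z : ZVec G M) : ℝ :=
  1 / 2 * wsq (Gam G M rho) (res G x z + (Gam G M rho)⁻¹ *ᵥ lamr)

/-- `(x, z, lam)` is a sequence of iterates of the proximal gradient consensus algorithm. -/
structure IsPGC (rho : V → V → ℝ) (ω : V → ℝ) (g : V → EuclideanSpace ℝ (Fin M) → ℝ)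
    (h : V → EuclideanSpace ℝ (Fin M) → EReal)
    (x : ℕ → XVec V M) (z : ℕ → ZVec G M) (lam : ℕ → LVec G M) : Prop where
  init_lam : (B G M)ᵀ *ᵥ lam 0 = 0
  init_z : z 0 = (1 / 2 : ℝ) • ((Mplus G M)ᵀ *ᵥ x 0)
  x_mem : ∀ r, x (r + 1) ∈ domH h
  x_min : ∀ r, IsMinOn (xObj G rho ω g h (x r) (z r) (lam r)) (domH h) (x (r + 1))
  z_min : ∀ r, IsMinOn (zObj G rho (x (r + 1)) (lam r)) Set.univ (z (r + 1))
  lam_step : ∀ r, lam (r + 1) = lam r + Gam G M rho *ᵥ res G (x (r + 1)) (z (r + 1))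

/-! ### Quantities in the rate -/

/-- The ergodic average `(1/r) ∑_{t=1}^r u^t`. -/
def avg {ι : Type*} (u : ℕ → ι → ℝ) (r : ℕ) : ι → ℝ :=
  (1 / (r : ℝ)) • ∑ t ∈ Finset.Icc 1 r, u t

/-- The diameter of `dom(h) ⊆ ℝ^(MN)` in the Euclidean norm. -/
def dx (h : V → EuclideanSpace ℝ (Fin M) → EReal) : ℝ :=
  sSup {d | ∃ u ∈ domH h, ∃ v ∈ domH h, d = euclNorm (u - v)}

/-- `sup_{u, v ∈ dom(h)} √(∑_{(i,j)} 2 ρ_ij ‖u_i - v_j‖²)`, the sum being over all arcs. -/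
def dz (rho : V → V → ℝ) (h : V → EuclideanSpace ℝ (Fin M) → EReal) : ℝ :=
  sSup {d | ∃ u ∈ domH h, ∃ v ∈ domH h,
    d = √(∑ e : G.Dart, 2 * rho e.fst e.snd * ‖blk u e.fst - blk v e.snd‖ ^ 2)}

/-- `sup_{‖λ‖ ≤ R} ‖λ - λ⁰‖_{Γ⁻¹}`. -/
def dlam (rho : V → V → ℝ) (lam0 : LVec G M) (R : ℝ) : ℝ :=
  sSup {d | ∃ l : LVec G M, euclNorm l ≤ R ∧ d = √(wsq (Gam G M rho)⁻¹ (l - lam0))}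

end PGC

end

set_option linter.unusedSectionVars false

/-! ### Convex functions whose gradient is Lipschitz on a convex set -/

section Convex

open Filter Topology

/-! Eliminating `z` turns the method into a proximal gradient step coupled with a multiplier step.
The `z`-update keeps every multiplier in the kernel of `Bᵀ`, hence makes each `z` the arc average of
`x`. Substituting this in the optimality condition of the `x`-update replaces the old multiplier by
the new one and leaves the proximal term of the metric `D = Ω + ½ M₊ (Ξ ⊗ I) M₊ᵀ`, half the matrix
in the hypotheses (`IsPGC.variational_inequality`). The natural energy is thus the squared distance
in `D` for `x` plus that in `Γ⁻¹` for the multiplier.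

For convergence, this inequality is added to the one satisfied by a saddle point. The gradients then
enter only through `⟨∇g(x) - ∇g(y), u - y⟩ ≥ -(P/4)‖u - x‖²` (`neg_quarter_le_inner_gradient_sub`),
so the energy decreases as soon as `D ≻ ½ P̃` (`IsPGC.fejer`). The steps vanish, a cluster point is
a saddle point, and the decreasing distance to that very point tends to zero. A saddle point to
start from comes from Slater's condition by extending a positive functional (`exists_multiplier`).

For the rate, the descent lemma replaces the three-point inequality. It costs `P̃` instead of `½
P̃`, but controls `f` itself (`IsPGC.descent`). Summing, applying Jensen's inequality and choosing a
multiplier aligned with the averaged residual give the bound.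

The gradients are Lipschitz only on domains that may have empty interior, so cocoercivity cannot be
quoted in its usual global form; it is recovered by subdividing segments inside a triangle. -/

theorem nonneg_of_le_add_mul {φ : ℝ → ℝ} {d c : ℝ} (hφ : HasDerivAt φ d 0)
    (hle : ∀ t, 0 < t → t ≤ 1 → φ 0 ≤ φ t + t * c) : 0 ≤ d + c := by
  have h1 := (hasDerivAt_iff_tendsto_slope.1 hφ).mono_left
    (nhdsWithin_mono 0 (fun t (ht : t ∈ Set.Ioi (0 : ℝ)) => ne_of_gt ht))
  have h2 : Tendsto (fun t => slope φ 0 t + c) (𝓝[>] 0) (𝓝 (d + c)) := h1.add_const c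
  refine ge_of_tendsto h2 ?_
  filter_upwards [Ioc_mem_nhdsGT (zero_lt_one' ℝ)] with t ht
  have h3 := hle t ht.1 ht.2
  have h4 : slope φ 0 t + c = (φ t + t * c - φ 0) / t := by
    rw [slope_def_field]; field_simp [ht.1.ne']; ring
  rw [h4]
  exact div_nonneg (by linarith) ht.1.le

variable {E : Type*} [NormedAddCommGroup E] [InnerProductSpace ℝ E] [CompleteSpace E]

theorem hasDerivAt_comp_line {g : E → ℝ} (hg : Differentiable ℝ g) (x v : E) (t : ℝ) :
    HasDerivAt (fun s : ℝ => g (x + s • v)) (inner ℝ (gradient g (x + t • v)) v) t := by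
  have h1 : HasDerivAt (fun s : ℝ => x + s • v) v t := by
    simpa using ((hasDerivAt_id t).smul_const v).const_add x
  have h2 := (hg (x + t • v)).hasGradientAt.hasFDerivAt.comp_hasDerivAt t h1
  rwa [InnerProductSpace.toDual_apply_apply] at h2

theorem ConvexOn.add_inner_gradient_le {g : E → ℝ} (hc : ConvexOn ℝ Set.univ g)
    (hg : Differentiable ℝ g) (x y : E) : g x + inner ℝ (gradient g x) (y - x) ≤ g y := by
  have h1 := (hasDerivAt_comp_line hg x (y - x) 0).neg
  have h2 := nonneg_of_le_add_mul (c := g y - g x) h1 (fun t ht0 ht1 => by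
    have h3 := hc.2 (Set.mem_univ x) (Set.mem_univ y) (sub_nonneg.2 ht1) ht0.le (by ring)
    have h4 : (1 - t) • x + t • y = x + t • (y - x) := by module
    rw [h4] at h3
    simp only [smul_eq_mul] at h3
    simp only [Pi.neg_apply, zero_smul, add_zero]
    linarith)
  simp only [zero_smul, add_zero] at h2
  linarith

/-- On the segment, `g` minus its quadratic model has nonpositive derivative, by Cauchy–Schwarz and
the Lipschitz bound. Only points of the segment are compared with `x`, so a bound on a convex set
suffices. -/
theorem le_add_inner_gradient_of_lipschitz {g : E → ℝ} (hg : Differentiable ℝ g) {C : Set E}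
    (hC : Convex ℝ C) {P : ℝ}
    (hL : ∀ y ∈ C, ∀ v ∈ C, ‖gradient g y - gradient g v‖ ≤ P * ‖y - v‖)
    {x y : E} (hx : x ∈ C) (hy : y ∈ C) :
    g y ≤ g x + inner ℝ (gradient g x) (y - x) + P / 2 * ‖y - x‖ ^ 2 := by
  set w := y - x with hw
  have hmem : ∀ t : ℝ, 0 ≤ t → t ≤ 1 → x + t • w ∈ C := fun t h0 h1 => by
    have := hC hx hy (sub_nonneg.2 h1) h0 (by ring)
    have h4 : (1 - t) • x + t • y = x + t • w := by rw [hw]; module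
    rwa [h4] at this
  have hd : ∀ t, HasDerivAt (fun t : ℝ => g (x + t • w) - t * inner ℝ (gradient g x) w
      - P / 2 * t ^ 2 * ‖w‖ ^ 2)
      (inner ℝ (gradient g (x + t • w)) w - inner ℝ (gradient g x) w - P * t * ‖w‖ ^ 2) t := by
    intro t
    have h1 := (hasDerivAt_comp_line hg x w t).sub
      ((hasDerivAt_id t).mul_const (inner ℝ (gradient g x) w))
    have h2 := h1.sub ((((hasDerivAt_id t).pow 2).const_mul (P / 2)).mul_const (‖w‖ ^ 2))
    refine h2.congr_deriv ?_
    push_cast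
    simp only [id]
    ring
  have hanti : AntitoneOn (fun t : ℝ => g (x + t • w) - t * inner ℝ (gradient g x) w
      - P / 2 * t ^ 2 * ‖w‖ ^ 2) (Set.Icc 0 1) := by
    refine antitoneOn_of_deriv_nonpos (convex_Icc 0 1)
      (fun t _ => (hd t).continuousAt.continuousWithinAt)
      (fun t _ => (hd t).differentiableAt.differentiableWithinAt) ?_
    intro t ht
    rw [interior_Icc] at ht
    rw [(hd t).deriv, ← inner_sub_left]
    have h1 := real_inner_le_norm (gradient g (x + t • w) - gradient g x) w
    have h2 := hL _ (hmem t ht.1.le ht.2.le) x hx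
    have h3 : ‖x + t • w - x‖ = t * ‖w‖ := by
      rw [add_sub_cancel_left, norm_smul, Real.norm_of_nonneg ht.1.le]
    rw [h3] at h2
    nlinarith [mul_le_mul_of_nonneg_right h2 (norm_nonneg w)]
  have := hanti (Set.left_mem_Icc.2 zero_le_one) (Set.right_mem_Icc.2 zero_le_one) zero_le_one
  simp only [one_smul, zero_smul, add_zero] at this
  have hxy : x + w = y := by rw [hw]; abel
  rw [hxy] at this
  linarith

/-! ### Cocoercivity relative to a convex set, without interior points -/

section ThreePoint

variable {g : E → ℝ} (hc : ConvexOn ℝ Set.univ g) (hg : Differentiable ℝ g) {C : Set E}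
  (hC : Convex ℝ C) {P : ℝ}
  (hL : ∀ y ∈ C, ∀ v ∈ C, ‖gradient g y - gradient g v‖ ≤ P * ‖y - v‖)

include hc hg hC hL

/-- Bound `g (x + w)` and `g (y - w)` above by the descent lemma at `x` and `y`, and below by the
tangents at `y` and `x`: all values of `g` cancel. -/
theorem cocoercive_of_add_mem_sub_mem {x y w : E} (hx : x ∈ C) (hy : y ∈ C) (hxw : x + w ∈ C)
    (hyw : y - w ∈ C) :
    0 ≤ inner ℝ (gradient g x - gradient g y) (x - y + (2 : ℝ) • w) + P * ‖w‖ ^ 2 := by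
  have h1 := le_add_inner_gradient_of_lipschitz hg hC hL hx hxw
  have h2 := le_add_inner_gradient_of_lipschitz hg hC hL hy hyw
  have h3 := hc.add_inner_gradient_le hg y (x + w)
  have h4 := hc.add_inner_gradient_le hg x (y - w)
  have e1 : x + w - x = w := by abel
  have e2 : y - w - y = -w := by abel
  rw [e1] at h1
  rw [e2, norm_neg] at h2
  simp only [inner_sub_left, inner_sub_right, inner_add_right, inner_smul_right,
    inner_neg_right] at *
  linarith

/-- The previous inequality is applied to consecutive points of a subdivision, with displacement `w
/ n`. The gradient differences telescope and the `n` quadratic errors add up to exactly `P ‖w‖²`, so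
nothing is lost while the displacements become arbitrarily small. -/
theorem cocoercive_of_segment_mem {x y w : E} {n : ℕ} (hn : 0 < n)
    (hp : ∀ s : ℝ, 0 ≤ s → s ≤ 1 → x + s • (y - x) + (1 / (n : ℝ)) • w ∈ C)
    (hm : ∀ s : ℝ, 0 ≤ s → s ≤ 1 → x + s • (y - x) - (1 / (n : ℝ)) • w ∈ C) :
    0 ≤ inner ℝ (gradient g x - gradient g y) (x - y + (2 : ℝ) • w) + P * ‖w‖ ^ 2 := by
  have hn' : (0 : ℝ) < n := by exact_mod_cast hn
  set p : ℕ → E := fun k => x + ((k : ℝ) / n) • (y - x) with hpdef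
  have h01 : ∀ k ≤ n, 0 ≤ (k : ℝ) / n ∧ (k : ℝ) / n ≤ 1 := fun k hk =>
    ⟨by positivity, (div_le_one hn').2 (by exact_mod_cast hk)⟩
  have hmem : ∀ k ≤ n, p k ∈ C := fun k hk => by
    have := hC (hp _ (h01 k hk).1 (h01 k hk).2) (hm _ (h01 k hk).1 (h01 k hk).2)
      (by norm_num : (0 : ℝ) ≤ 1 / 2) (by norm_num : (0 : ℝ) ≤ 1 / 2) (by norm_num)
    convert this using 1
    simp only [hpdef]
    module
  have hstep : ∀ k ∈ Finset.range n,
      0 ≤ inner ℝ (gradient g (p k) - gradient g (p (k + 1))) (x - y + (2 : ℝ) • w)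
        + P * ‖w‖ ^ 2 / n := by
    intro k hk
    have hk' := Finset.mem_range.1 hk
    have h := cocoercive_of_add_mem_sub_mem hc hg hC hL (w := (1 / (n : ℝ)) • w)
      (hmem k hk'.le) (hmem (k + 1) hk') (hp _ (h01 k hk'.le).1 (h01 k hk'.le).2)
      (hm _ (h01 (k + 1) hk').1 (h01 (k + 1) hk').2)
    -- Both the gap between neighbours and the displacement scale by `1 / n`, so the test vector is
    -- the same for every `k`.
    have e : p k - p (k + 1) + (2 : ℝ) • (1 / (n : ℝ)) • w
        = (1 / (n : ℝ)) • (x - y + (2 : ℝ) • w) := by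
      simp only [hpdef]
      push_cast
      rw [add_div]
      module
    rw [e, inner_smul_right, norm_smul, Real.norm_of_nonneg (by positivity)] at h
    have h5 := mul_nonneg hn'.le h
    have e2 : (n : ℝ) * (1 / n * inner ℝ (gradient g (p k) - gradient g (p (k + 1)))
        (x - y + (2 : ℝ) • w) + P * (1 / n * ‖w‖) ^ 2)
        = inner ℝ (gradient g (p k) - gradient g (p (k + 1))) (x - y + (2 : ℝ) • w)
        + P * ‖w‖ ^ 2 / n := by
      field_simp
    rwa [e2] at h5
  have hsum := Finset.sum_nonneg hstep
  rw [Finset.sum_add_distrib, ← sum_inner, Finset.sum_range_sub'] at hsum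
  have e0 : p 0 = x := by simp [hpdef]
  have e1 : p n = y := by
    simp only [hpdef]; rw [div_self hn'.ne']; module
  rw [e0, e1] at hsum
  simp only [Finset.sum_const, Finset.card_range, nsmul_eq_mul] at hsum
  rwa [mul_div_cancel₀ _ hn'.ne'] at hsum

/-- The consequence of cocoercivity used for forward-backward steps.  The gradient is only
assumed to be Lipschitz on a convex set, which may have empty interior. -/
theorem neg_quarter_le_inner_gradient_sub {x y u : E} (hx : x ∈ C) (hy : y ∈ C) (hu : u ∈ C) :
    0 ≤ inner ℝ (gradient g x - gradient g y) (u - y) + P / 4 * ‖u - x‖ ^ 2 := by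
  -- The centroid of the triangle: contracting towards it by `t` makes all barycentric coordinates
  -- at least `t / 3`, which leaves room for small displacements.
  set c : E := (1 / 3 : ℝ) • x + (1 / 3 : ℝ) • y + (1 / 3 : ℝ) • u with hcdef
  have hcomb : ∀ a b d : ℝ, 0 ≤ a → 0 ≤ b → 0 ≤ d → a + b + d = 1 →
      a • x + b • y + d • u ∈ C := by
    intro a b d ha hb hd habd
    by_cases hab : a + b = 0
    · have : a = 0 := by linarith
      have hb0 : b = 0 := by linarith
      have hd1 : d = 1 := by linarith
      simpa [this, hb0, hd1] using hu
    · have hab' : 0 < a + b := lt_of_le_of_ne (by linarith) (Ne.symm hab)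
      have h1 := hC hx hy (a := a / (a + b)) (b := b / (a + b)) (by positivity) (by positivity)
        (by field_simp)
      have h2 := hC h1 hu hab'.le hd habd
      rw [smul_add, smul_smul, smul_smul, mul_div_cancel₀ _ hab, mul_div_cancel₀ _ hab] at h2
      exact h2
  have hin : ∀ t : ℝ, 0 < t → t < 1 →
      0 ≤ inner ℝ (gradient g (x + t • (c - x)) - gradient g (y + t • (c - y)))
        ((1 - t) • (u - y)) + P / 4 * ‖(1 - t) • (u - x)‖ ^ 2 := by
    intro t ht0 ht1
    -- A displacement changes the coordinates of `x` and `u` by `(1 - t) / (2n)`; this `n` keeps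
    -- that below `t / 3`.
    obtain ⟨n, hn⟩ := exists_nat_gt (3 / (2 * t))
    have hn0 : (0 : ℝ) < n := lt_trans (by positivity) hn
    have hn1 : 3 / 2 * (1 / (n : ℝ)) ≤ t := by
      rw [div_lt_iff₀ (by positivity)] at hn
      rw [mul_one_div, div_le_iff₀ hn0]
      nlinarith
    have hnn : (0 : ℝ) ≤ 1 / n := by positivity
    -- Half of the contracted `u - x` as displacement turns `x - y + 2w` into `u - y` and `P ‖w‖²`
    -- into the quarter term.
    have h := cocoercive_of_segment_mem hc hg hC hL (x := x + t • (c - x)) (y := y + t • (c - y))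
      (w := ((1 - t) / 2) • (u - x)) (n := n) (by exact_mod_cast hn0)
      (fun s hs0 hs1 => by
        have := hcomb ((1 - t) * (1 - s) + t / 3 - (1 - t) / 2 * (1 / n))
          ((1 - t) * s + t / 3) (t / 3 + (1 - t) / 2 * (1 / n))
          (by nlinarith [mul_nonneg (sub_nonneg.2 ht1.le) (sub_nonneg.2 hs1)])
          (by nlinarith [mul_nonneg (sub_nonneg.2 ht1.le) hs0])
          (by nlinarith [mul_nonneg (sub_nonneg.2 ht1.le) hnn]) (by ring)
        convert this using 1
        rw [hcdef]
        module)
      (fun s hs0 hs1 => by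
        have := hcomb ((1 - t) * (1 - s) + t / 3 + (1 - t) / 2 * (1 / n))
          ((1 - t) * s + t / 3) (t / 3 - (1 - t) / 2 * (1 / n))
          (by nlinarith [mul_nonneg (sub_nonneg.2 ht1.le) (sub_nonneg.2 hs1),
            mul_nonneg (sub_nonneg.2 ht1.le) hnn])
          (by nlinarith [mul_nonneg (sub_nonneg.2 ht1.le) hs0])
          (by nlinarith [mul_nonneg (sub_nonneg.2 ht1.le) hnn]) (by ring)
        convert this using 1
        rw [hcdef]
        module)
    have e1 : x + t • (c - x) - (y + t • (c - y)) + (2 : ℝ) • ((1 - t) / 2) • (u - x)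
        = (1 - t) • (u - y) := by module
    have e2 : P * ‖((1 - t) / 2) • (u - x)‖ ^ 2 = P / 4 * ‖(1 - t) • (u - x)‖ ^ 2 := by
      rw [norm_smul, norm_smul, norm_div]
      simp only [Real.norm_ofNat]
      ring
    rwa [e1, e2] at h
  have hcC : c ∈ C := hcomb _ _ _ (by norm_num) (by norm_num) (by norm_num) (by norm_num)
  -- Letting `t → 0` needs continuity of the gradient only along segments inside `C`, where the
  -- Lipschitz bound provides it.
  have hcont : ∀ p ∈ C, Tendsto (fun t : ℝ => gradient g (p + t • (c - p))) (𝓝[>] 0)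
      (𝓝 (gradient g p)) := by
    intro p hp
    rw [tendsto_iff_norm_sub_tendsto_zero]
    have hlim : Tendsto (fun t : ℝ => P * ‖t • (c - p)‖) (𝓝[>] 0) (𝓝 0) := by
      have : Continuous (fun t : ℝ => P * ‖t • (c - p)‖) := by fun_prop
      have h0 := this.tendsto 0
      simp only [zero_smul, norm_zero, mul_zero] at h0
      exact h0.mono_left nhdsWithin_le_nhds
    refine squeeze_zero' (Eventually.of_forall fun t => norm_nonneg _) ?_ hlim
    filter_upwards [Ioo_mem_nhdsGT (zero_lt_one' ℝ)] with t ht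
    have hmem : p + t • (c - p) ∈ C := by
      have := hC hp hcC (sub_nonneg.2 ht.2.le) ht.1.le (by ring)
      convert this using 1
      module
    have := hL _ hmem p hp
    rwa [add_sub_cancel_left] at this
  have hlim : Tendsto (fun t : ℝ =>
      inner ℝ (gradient g (x + t • (c - x)) - gradient g (y + t • (c - y)))
        ((1 - t) • (u - y)) + P / 4 * ‖(1 - t) • (u - x)‖ ^ 2) (𝓝[>] 0)
      (𝓝 (inner ℝ (gradient g x - gradient g y) ((1 - (0 : ℝ)) • (u - y))
        + P / 4 * ‖(1 - (0 : ℝ)) • (u - x)‖ ^ 2)) := by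
    have hc1 : Tendsto (fun t : ℝ => (1 - t) • (u - y)) (𝓝[>] 0) (𝓝 ((1 - (0 : ℝ)) • (u - y))) :=
      (Continuous.tendsto (by fun_prop) 0).mono_left nhdsWithin_le_nhds
    have hc2 : Tendsto (fun t : ℝ => P / 4 * ‖(1 - t) • (u - x)‖ ^ 2) (𝓝[>] 0)
        (𝓝 (P / 4 * ‖(1 - (0 : ℝ)) • (u - x)‖ ^ 2)) :=
      (Continuous.tendsto (f := fun t : ℝ => P / 4 * ‖(1 - t) • (u - x)‖ ^ 2)
        (by fun_prop) 0).mono_left nhdsWithin_le_nhds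
    exact (((hcont x hx).sub (hcont y hy)).inner hc1).add hc2
  rw [sub_zero, one_smul, one_smul] at hlim
  refine ge_of_tendsto hlim ?_
  filter_upwards [Ioo_mem_nhdsGT (zero_lt_one' ℝ)] with t ht
  exact hin t ht.1 ht.2

end ThreePoint

end Convex

namespace PGC

section Coordinates

variable {V : Type*} [Fintype V] [DecidableEq V] (G : SimpleGraph V) [DecidableRel G.Adj] {M : ℕ}

/-! ### The matrices in coordinates -/

theorem A₁_mulVec (x : XVec V M) (q : G.Dart × Fin M) :
    (A₁ G M *ᵥ x) q = x (q.1.fst, q.2) := by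
  simp [A₁, Matrix.mulVec, dotProduct, Fintype.sum_prod_type, Matrix.one_apply]

theorem A₂_mulVec (x : XVec V M) (q : G.Dart × Fin M) :
    (A₂ G M *ᵥ x) q = x (q.1.snd, q.2) := by
  simp [A₂, Matrix.mulVec, dotProduct, Fintype.sum_prod_type, Matrix.one_apply]

theorem A_mulVec_inl (x : XVec V M) (q : G.Dart × Fin M) :
    (A G M *ᵥ x) (Sum.inl q) = x (q.1.fst, q.2) := by
  rw [A, Matrix.fromRows_mulVec, Sum.elim_inl, A₁_mulVec]

theorem A_mulVec_inr (x : XVec V M) (q : G.Dart × Fin M) :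
    (A G M *ᵥ x) (Sum.inr q) = x (q.1.snd, q.2) := by
  rw [A, Matrix.fromRows_mulVec, Sum.elim_inr, A₂_mulVec]

theorem B_mulVec_inl (z : ZVec G M) (q : G.Dart × Fin M) :
    (B G M *ᵥ z) (Sum.inl q) = -z q := by
  rw [B, Matrix.fromRows_mulVec, Sum.elim_inl, Matrix.neg_mulVec, Matrix.one_mulVec, Pi.neg_apply]

theorem B_mulVec_inr (z : ZVec G M) (q : G.Dart × Fin M) :
    (B G M *ᵥ z) (Sum.inr q) = -z q := by
  rw [B, Matrix.fromRows_mulVec, Sum.elim_inr, Matrix.neg_mulVec, Matrix.one_mulVec, Pi.neg_apply]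

theorem res_inl (x : XVec V M) (z : ZVec G M) (q : G.Dart × Fin M) :
    res G x z (Sum.inl q) = x (q.1.fst, q.2) - z q := by
  rw [res, Pi.add_apply, A_mulVec_inl, B_mulVec_inl, sub_eq_add_neg]

theorem res_inr (x : XVec V M) (z : ZVec G M) (q : G.Dart × Fin M) :
    res G x z (Sum.inr q) = x (q.1.snd, q.2) - z q := by
  rw [res, Pi.add_apply, A_mulVec_inr, B_mulVec_inr, sub_eq_add_neg]

theorem res_add (x y : XVec V M) (z w : ZVec G M) :
    res G (x + y) (z + w) = res G x z + res G y w := by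
  simp only [res, Matrix.mulVec_add]; abel

theorem res_smul (c : ℝ) (x : XVec V M) (z : ZVec G M) :
    res G (c • x) (c • z) = c • res G x z := by
  simp only [res, Matrix.mulVec_smul, smul_add]

theorem B_transpose_mulVec (l : LVec G M) (q : G.Dart × Fin M) :
    ((B G M)ᵀ *ᵥ l) q = -(l (Sum.inl q) + l (Sum.inr q)) := by
  have h : (B G M)ᵀ = Matrix.fromCols (-1) (-1) := by
    rw [B, Matrix.transpose_fromRows, Matrix.transpose_neg, Matrix.transpose_one]
  rw [h]
  have h2 : l = Sum.elim (l ∘ Sum.inl) (l ∘ Sum.inr) := (Sum.elim_comp_inl_inr l).symm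
  conv_lhs => rw [h2]
  rw [Matrix.fromCols_mulVec_sumElim]
  simp [Matrix.neg_mulVec]
  ring

theorem Mplus_transpose_mulVec (x : XVec V M) (q : G.Dart × Fin M) :
    ((Mplus G M)ᵀ *ᵥ x) q = x (q.1.fst, q.2) + x (q.1.snd, q.2) := by
  rw [Mplus, Matrix.transpose_add, Matrix.transpose_transpose, Matrix.transpose_transpose,
    Matrix.add_mulVec, Pi.add_apply, A₁_mulVec, A₂_mulVec]

theorem XiI_eq_diagonal (rho : V → V → ℝ) :
    XiI G M rho = Matrix.diagonal fun q => rho q.1.fst q.1.snd := by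
  rw [XiI, Xi, ← Matrix.diagonal_one, Matrix.diagonal_kronecker_diagonal]
  simp

theorem diagI_eq_diagonal (c : V → ℝ) :
    diagI M c = Matrix.diagonal fun q => c q.1 := by
  rw [diagI, ← Matrix.diagonal_one, Matrix.diagonal_kronecker_diagonal]
  simp

/-- The diagonal of `Γ`. -/
def gam (rho : V → V → ℝ) (M : ℕ) : (G.Dart × Fin M) ⊕ (G.Dart × Fin M) → ℝ :=
  Sum.elim (fun q => rho q.1.fst q.1.snd) (fun q => rho q.1.fst q.1.snd)

theorem Gam_eq_diagonal (rho : V → V → ℝ) : Gam G M rho = Matrix.diagonal (gam G rho M) := by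
  rw [Gam, XiI_eq_diagonal, Matrix.fromBlocks_diagonal, gam]

theorem gam_pos {rho : V → V → ℝ} (hrho : ∀ i j, G.Adj i j → 0 < rho i j)
    (p : (G.Dart × Fin M) ⊕ (G.Dart × Fin M)) : 0 < gam G rho M p := by
  rcases p with q | q <;> exact hrho _ _ q.1.adj

theorem Gam_inv_eq_diagonal {rho : V → V → ℝ} (hrho : ∀ i j, G.Adj i j → 0 < rho i j) :
    (Gam G M rho)⁻¹ = Matrix.diagonal fun p => (gam G rho M p)⁻¹ := by
  apply Matrix.inv_eq_right_inv
  rw [Gam_eq_diagonal, Matrix.diagonal_mul_diagonal, ← Matrix.diagonal_one]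
  congr 1
  ext p
  exact mul_inv_cancel₀ (gam_pos G hrho p).ne'

/-! ### Quadratic forms -/

section Quadratic

variable {ι : Type*} [Fintype ι]

theorem wsq_diagonal [DecidableEq ι] (d v : ι → ℝ) :
    wsq (Matrix.diagonal d) v = ∑ i, d i * v i ^ 2 := by
  simp only [wsq, dotProduct, Matrix.mulVec_diagonal]
  exact Finset.sum_congr rfl fun i _ => by ring

theorem dotProduct_mulVec_comm {Q : Matrix ι ι ℝ} (hQ : Qᵀ = Q) (u v : ι → ℝ) :
    u ⬝ᵥ (Q *ᵥ v) = v ⬝ᵥ (Q *ᵥ u) := by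
  rw [Matrix.dotProduct_mulVec, ← Matrix.mulVec_transpose, hQ, dotProduct_comm]

theorem wsq_add_smul {Q : Matrix ι ι ℝ} (hQ : Qᵀ = Q) (u v : ι → ℝ) (t : ℝ) :
    wsq Q (u + t • v) = wsq Q u + t * (2 * (u ⬝ᵥ (Q *ᵥ v))) + t ^ 2 * wsq Q v := by
  simp only [wsq, Matrix.mulVec_add, Matrix.mulVec_smul, add_dotProduct, dotProduct_add,
    smul_dotProduct, dotProduct_smul, smul_eq_mul, dotProduct_mulVec_comm hQ v u]
  ring

theorem wsq_sub_eq {Q : Matrix ι ι ℝ} (hQ : Qᵀ = Q) (u v : ι → ℝ) :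
    wsq Q (u - v) = wsq Q u - 2 * (u ⬝ᵥ (Q *ᵥ v)) + wsq Q v := by
  have := wsq_add_smul hQ u v (-1)
  rw [neg_one_smul, ← sub_eq_add_neg] at this
  rw [this]; ring

/-- The polarization identity behind the telescoping of weighted distances. -/
theorem dotProduct_mulVec_sub_sub {Q : Matrix ι ι ℝ} (hQ : Qᵀ = Q) (a b c : ι → ℝ) :
    (b - a) ⬝ᵥ (Q *ᵥ (c - b))
      = 1 / 2 * (wsq Q (a - c) - wsq Q (b - c) - wsq Q (b - a)) := by
  simp only [wsq_sub_eq hQ, Matrix.mulVec_sub, dotProduct_sub, sub_dotProduct]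
  rw [dotProduct_mulVec_comm hQ b a]
  simp only [wsq]
  ring

theorem wsq_sub_matrix (Q R : Matrix ι ι ℝ) (v : ι → ℝ) : wsq (Q - R) v = wsq Q v - wsq R v := by
  simp only [wsq, Matrix.sub_mulVec, dotProduct_sub]

theorem wsq_smul_matrix (c : ℝ) (Q : Matrix ι ι ℝ) (v : ι → ℝ) :
    wsq (c • Q) v = c * wsq Q v := by
  simp only [wsq, Matrix.smul_mulVec, dotProduct_smul, smul_eq_mul]

theorem wsq_pos {Q : Matrix ι ι ℝ} (hQ : Q.PosDef) {v : ι → ℝ} (hv : v ≠ 0) : 0 < wsq Q v := by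
  simpa [wsq] using hQ.dotProduct_mulVec_pos hv

theorem wsq_zero (Q : Matrix ι ι ℝ) : wsq Q 0 = 0 := by simp [wsq]

theorem wsq_nonneg {Q : Matrix ι ι ℝ} (hQ : Q.PosDef) (v : ι → ℝ) : 0 ≤ wsq Q v := by
  rcases eq_or_ne v 0 with rfl | hv
  · rw [wsq_zero]
  · exact (wsq_pos hQ hv).le

theorem wsq_neg (Q : Matrix ι ι ℝ) (v : ι → ℝ) : wsq Q (-v) = wsq Q v := by
  simp [wsq, Matrix.mulVec_neg]

theorem euclNorm_sq (v : ι → ℝ) : euclNorm v ^ 2 = ∑ i, v i ^ 2 := by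
  simp [euclNorm, EuclideanSpace.norm_sq_eq]

end Quadratic

/-- The proximal metric `Ω + ½ M₊ (Ξ ⊗ I) M₊ᵀ` of the `x`-update. -/
noncomputable def proxMetric (M : ℕ) (rho : V → V → ℝ) (ω : V → ℝ) :
    Matrix (V × Fin M) (V × Fin M) ℝ :=
  diagI M ω + (1 / 2 : ℝ) • (Mplus G M * XiI G M rho * (Mplus G M)ᵀ)

theorem proxMetric_transpose (rho : V → V → ℝ) (ω : V → ℝ) :
    (proxMetric G M rho ω)ᵀ = proxMetric G M rho ω := by
  rw [proxMetric, diagI_eq_diagonal, XiI_eq_diagonal]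
  simp [Matrix.mul_assoc]

theorem two_smul_proxMetric (rho : V → V → ℝ) (ω : V → ℝ) :
    (2 : ℝ) • diagI M ω + Mplus G M * XiI G M rho * (Mplus G M)ᵀ
      = (2 : ℝ) • proxMetric G M rho ω := by
  rw [proxMetric, smul_add, smul_smul]; norm_num

theorem dotProduct_proxMetric_mulVec (rho : V → V → ℝ) (ω : V → ℝ) (u v : XVec V M) :
    u ⬝ᵥ (proxMetric G M rho ω *ᵥ v) = u ⬝ᵥ (diagI M ω *ᵥ v)
      + 1 / 2 * (((Mplus G M)ᵀ *ᵥ u) ⬝ᵥ (XiI G M rho *ᵥ ((Mplus G M)ᵀ *ᵥ v))) := by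
  rw [proxMetric, Matrix.add_mulVec, dotProduct_add, Matrix.smul_mulVec, dotProduct_smul,
    smul_eq_mul, ← Matrix.mulVec_mulVec, ← Matrix.mulVec_mulVec, Matrix.dotProduct_mulVec u (Mplus G M),
    ← Matrix.mulVec_transpose]

/-! ### Sums over arcs and the two forms of the stepsize matrix -/

theorem sum_dart_eq (F : V → V → ℝ) :
    ∑ e : G.Dart, F e.fst e.snd = ∑ a, ∑ b, if G.Adj a b then F a b else 0 := by
  rw [← Fintype.sum_prod_type' (f := fun a b => if G.Adj a b then F a b else 0),
    ← Finset.sum_filter]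
  refine Finset.sum_nbij (fun e => e.toProd) (fun e _ => by simp)
    (fun a _ b _ hab => SimpleGraph.Dart.ext _ _ hab) (fun p hp => ?_) (fun _ _ => rfl)
  exact ⟨⟨p, by simpa using hp⟩, by simp, rfl⟩

theorem Mplus_eq_kronecker : Mplus G M
    = (Matrix.of fun (i : V) (e : G.Dart) =>
        (if e.fst = i then (1 : ℝ) else 0) + if e.snd = i then 1 else 0) ⊗ₖ
      (1 : Matrix (Fin M) (Fin M) ℝ) := by
  ext ⟨i, k⟩ ⟨e, l⟩
  by_cases hkl : k = l <;> simp [Mplus, A₁, A₂, hkl, eq_comm]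

theorem beta_eq (rho : V → V → ℝ) (ω : V → ℝ) (i : V) :
    beta G rho ω i = ∑ j, (if G.Adj i j then rho i j + rho j i else 0) + ω i := by
  rw [beta, mul_add, Finset.mul_sum, ← Finset.sum_filter]
  congr 1
  · refine Finset.sum_congr (by ext; simp) fun j _ => by ring
  · ring

theorem laplacian_identity {rho : V → V → ℝ} (hrho : ∀ i j, G.Adj i j → 0 < rho i j)
    {ω : V → ℝ} (hω : ∀ i, 0 ≤ ω i) :
    (2 : ℝ) • Matrix.diagonal ω
      + (Matrix.of fun (i : V) (e : G.Dart) =>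
        (if e.fst = i then (1 : ℝ) else 0) + if e.snd = i then 1 else 0) * Xi G rho
        * (Matrix.of fun (i : V) (e : G.Dart) =>
        (if e.fst = i then (1 : ℝ) else 0) + if e.snd = i then 1 else 0)ᵀ
      = Matrix.diagonal (beta G rho ω) * W G rho ω + Matrix.diagonal (beta G rho ω) := by
  ext i j
  have hsum : 0 ≤ ∑ j, (if G.Adj i j then rho i j + rho j i else 0) :=
    Finset.sum_nonneg fun j _ => by
      split_ifs with hij
      · exact (add_pos (hrho _ _ hij) (hrho _ _ hij.symm)).le
      · exact le_rfl
  have hprod : ∀ i j, (∑ e : G.Dart, ((if e.fst = i then (1 : ℝ) else 0)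
        + if e.snd = i then 1 else 0) * rho e.fst e.snd
        * ((if e.fst = j then (1 : ℝ) else 0) + if e.snd = j then 1 else 0))
      = (if i = j then ∑ b, (if G.Adj i b then rho i b + rho b i else 0) else 0)
        + if G.Adj i j then rho i j + rho j i else 0 := by
    intro i j
    rw [sum_dart_eq G fun a b => ((if a = i then (1 : ℝ) else 0)
        + if b = i then 1 else 0) * rho a b
        * ((if a = j then (1 : ℝ) else 0) + if b = j then 1 else 0)]
    set c : V → V → ℝ := fun a b => if G.Adj a b then rho a b else 0 with hc
    -- Expansion of the product by which endpoint is `i` and which is `j`: tail–tail and head–head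
    -- force `i = j`; the two mixed terms give the off-diagonal entries.
    have h1 : ∀ a b, (if G.Adj a b then ((if a = i then (1 : ℝ) else 0)
        + if b = i then 1 else 0) * rho a b
        * ((if a = j then (1 : ℝ) else 0) + if b = j then 1 else 0) else 0)
        = (if a = i then if i = j then c i b else 0 else 0)
        + (if a = i then if b = j then c i j else 0 else 0)
        + (if a = j then if b = i then c j i else 0 else 0)
        + (if b = i then if i = j then c a i else 0 else 0) := by
      intro a b
      by_cases ha : a = i <;> by_cases hb : b = i <;> by_cases ha' : a = j <;>
        by_cases hb' : b = j <;> simp [hc] <;> grind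
    simp only [h1, Finset.sum_add_distrib, Finset.sum_ite_irrel, Finset.sum_ite_eq',
      Finset.mem_univ, if_true, Finset.sum_const_zero]
    have h2 : ∀ a b, (if G.Adj a b then rho a b + rho b a else 0) = c a b + c b a := by
      intro a b
      simp only [hc, G.adj_comm b a]
      split_ifs <;> simp
    simp only [h2, Finset.sum_add_distrib]
    split_ifs <;> ring
  have hE : ((Matrix.of fun (i : V) (e : G.Dart) =>
        (if e.fst = i then (1 : ℝ) else 0) + if e.snd = i then 1 else 0) * Xi G rho
        * (Matrix.of fun (i : V) (e : G.Dart) =>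
        (if e.fst = i then (1 : ℝ) else 0) + if e.snd = i then 1 else 0)ᵀ) i j
      = (if i = j then ∑ b, (if G.Adj i b then rho i b + rho b i else 0) else 0)
        + if G.Adj i j then rho i j + rho j i else 0 := by
    rw [← hprod, Matrix.mul_apply]
    refine Finset.sum_congr rfl fun e _ => ?_
    rw [Xi, Matrix.mul_diagonal]
    rfl
  rw [Matrix.add_apply, hE, Matrix.add_apply, Matrix.diagonal_mul, Matrix.smul_apply, W,
    Matrix.of_apply]
  by_cases hij : i = j
  · subst hij
    -- If `β i = 0`, all its nonnegative summands vanish, so `ω i = 0` and the convention `0 / 0 =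
    -- 0` is harmless.
    have hb : beta G rho ω i * (ω i / beta G rho ω i) = ω i := by
      by_cases h0 : beta G rho ω i = 0
      · rw [beta_eq] at h0
        have : ω i = 0 := by linarith [hω i]
        rw [this]; simp
      · exact mul_div_cancel₀ _ h0
    simp only [SimpleGraph.irrefl, if_false, if_true, Matrix.diagonal_apply_eq, smul_eq_mul, hb]
    rw [beta_eq]; ring
  · simp only [Matrix.diagonal_apply_ne _ hij, hij, if_false, smul_zero, add_zero, zero_add]
    split_ifs with ha
    · have : beta G rho ω i ≠ 0 := by
        rw [beta_eq]
        have h1 := Finset.single_le_sum (f := fun j => if G.Adj i j then rho i j + rho j i else 0)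
          (fun j _ => by
            split_ifs with hij
            · exact (add_pos (hrho _ _ hij) (hrho _ _ hij.symm)).le
            · exact le_rfl) (Finset.mem_univ j)
        simp only [ha, if_true] at h1
        linarith [hω i, hrho _ _ ha, hrho _ _ ha.symm]
      rw [mul_div_cancel₀ _ this, add_comm]
    · simp

theorem stepsize_identity {rho : V → V → ℝ} (hrho : ∀ i j, G.Adj i j → 0 < rho i j)
    {ω : V → ℝ} (hω : ∀ i, 0 ≤ ω i) :
    (2 : ℝ) • diagI M ω + Mplus G M * XiI G M rho * (Mplus G M)ᵀ
      = Ups G M rho ω * (W G rho ω ⊗ₖ (1 : Matrix (Fin M) (Fin M) ℝ)) + Ups G M rho ω := by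
  rw [Mplus_eq_kronecker, XiI, Ups, diagI, diagI, ← Matrix.kroneckerMap_transpose,
    Matrix.transpose_one, ← Matrix.mul_kronecker_mul, ← Matrix.mul_kronecker_mul,
    ← Matrix.mul_kronecker_mul, ← Matrix.smul_kronecker, Matrix.one_mul, Matrix.one_mul,
    ← Matrix.add_kronecker, ← Matrix.add_kronecker, laplacian_identity G hrho hω]

end Coordinates

section Objective

variable {V : Type*} [Fintype V] {M : ℕ}

/-! ### The objective -/

/-- The nonsmooth part `h(x) = ∑ h_i(x_i)`, used only on `domH h`. -/
noncomputable def hsum (h : V → EuclideanSpace ℝ (Fin M) → EReal) (x : XVec V M) : ℝ :=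
  ∑ i, (h i (blk x i)).toReal

/-- The smooth part `g(x) = ∑ g_i(x_i)`. -/
noncomputable def gsum (g : V → EuclideanSpace ℝ (Fin M) → ℝ) (x : XVec V M) : ℝ :=
  ∑ i, g i (blk x i)

theorem f_eq (g : V → EuclideanSpace ℝ (Fin M) → ℝ) (h : V → EuclideanSpace ℝ (Fin M) → EReal)
    (x : XVec V M) : f g h x = gsum g x + hsum h x := by
  rw [f, gsum, hsum, Finset.sum_add_distrib]

theorem blk_add (x y : XVec V M) (i : V) : blk (x + y) i = blk x i + blk y i := rfl

theorem blk_sub (x y : XVec V M) (i : V) : blk (x - y) i = blk x i - blk y i := rfl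

theorem blk_smul (c : ℝ) (x : XVec V M) (i : V) : blk (c • x) i = c • blk x i := rfl

theorem continuous_blk (i : V) : Continuous fun x : XVec V M => blk x i :=
  (PiLp.continuous_toLp 2 _).comp (continuous_pi fun k => continuous_apply (i, k))

theorem norm_blk_sq (x : XVec V M) (i : V) : ‖blk x i‖ ^ 2 = ∑ k, x (i, k) ^ 2 := by
  simp [blk, EuclideanSpace.norm_sq_eq]

theorem sum_inner_gradient (g : V → EuclideanSpace ℝ (Fin M) → ℝ) (x v : XVec V M) :
    ∑ i, inner ℝ (gradient (g i) (blk x i)) (blk v i) = gradStack g x ⬝ᵥ v := by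
  rw [dotProduct, Fintype.sum_prod_type]
  refine Finset.sum_congr rfl fun i _ => ?_
  rw [PiLp.inner_apply]
  exact Finset.sum_congr rfl fun k _ => by simp [gradStack, blk, mul_comm]

variable [DecidableEq V]

theorem wsq_diagI (c : V → ℝ) (v : XVec V M) :
    wsq (diagI M c) v = ∑ i, c i * ‖blk v i‖ ^ 2 := by
  rw [diagI_eq_diagonal, wsq_diagonal, Fintype.sum_prod_type]
  simp only [norm_blk_sq, Finset.mul_sum]

variable {g : V → EuclideanSpace ℝ (Fin M) → ℝ} {h : V → EuclideanSpace ℝ (Fin M) → EReal}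
  {P : V → ℝ}

theorem convex_domH (hA : Assumption g h P) : Convex ℝ (domH h) := by
  intro x hx y hy a b ha hb hab i
  rw [blk_add, blk_smul, blk_smul]
  exact (hA.h_closed i).convex.1 (hx i) (hy i) ha hb hab

theorem convexOn_hsum (hA : Assumption g h P) : ConvexOn ℝ (domH h) (hsum h) := by
  refine ⟨convex_domH hA, fun x hx y hy a b ha hb hab => ?_⟩
  simp only [hsum, smul_eq_mul, Finset.mul_sum, ← Finset.sum_add_distrib]
  exact Finset.sum_le_sum fun i _ => (hA.h_closed i).convex.2 (hx i) (hy i) ha hb hab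

theorem convexOn_gsum (hA : Assumption g h P) : ConvexOn ℝ (domH h) (gsum g) := by
  refine ⟨convex_domH hA, fun x hx y hy a b ha hb hab => ?_⟩
  simp only [gsum, smul_eq_mul, Finset.mul_sum, ← Finset.sum_add_distrib]
  exact Finset.sum_le_sum fun i _ => (hA.g_convex i).2 (Set.mem_univ (blk x i))
    (Set.mem_univ (blk y i)) ha hb hab

theorem convexOn_f (hA : Assumption g h P) : ConvexOn ℝ (domH h) (f g h) :=
  ((convexOn_gsum hA).add (convexOn_hsum hA)).congr fun x _ => (f_eq g h x).symm

theorem gsum_add_le (hA : Assumption g h P) (x y : XVec V M) :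
    gsum g x + gradStack g x ⬝ᵥ (y - x) ≤ gsum g y := by
  rw [← sum_inner_gradient, gsum, gsum, ← Finset.sum_add_distrib]
  refine Finset.sum_le_sum fun i _ => ?_
  rw [blk_sub]
  exact (hA.g_convex i).add_inner_gradient_le (hA.g_diff i) (blk x i) (blk y i)

theorem gsum_le_add (hA : Assumption g h P) {x y : XVec V M} (hx : x ∈ domH h)
    (hy : y ∈ domH h) :
    gsum g y ≤ gsum g x + gradStack g x ⬝ᵥ (y - x) + 1 / 2 * wsq (diagI M P) (y - x) := by
  rw [← sum_inner_gradient, gsum, gsum, wsq_diagI, Finset.mul_sum, ← Finset.sum_add_distrib,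
    ← Finset.sum_add_distrib]
  refine Finset.sum_le_sum fun i _ => ?_
  have := le_add_inner_gradient_of_lipschitz (hA.g_diff i) (hA.h_closed i).convex.1
    (hA.lipschitz i) (hx i) (hy i)
  rw [blk_sub]
  linarith

theorem gradStack_three_point (hA : Assumption g h P) {x y u : XVec V M} (hx : x ∈ domH h)
    (hy : y ∈ domH h) (hu : u ∈ domH h) :
    0 ≤ (gradStack g x - gradStack g y) ⬝ᵥ (u - y) + 1 / 4 * wsq (diagI M P) (u - x) := by
  rw [sub_dotProduct, ← sum_inner_gradient, ← sum_inner_gradient, wsq_diagI, Finset.mul_sum,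
    ← Finset.sum_sub_distrib, ← Finset.sum_add_distrib]
  refine Finset.sum_nonneg fun i _ => ?_
  have := neg_quarter_le_inner_gradient_sub (hA.g_convex i) (hA.g_diff i)
    (hA.h_closed i).convex.1 (hA.lipschitz i) (hx i) (hy i) (hu i)
  rw [inner_sub_left] at this
  rw [blk_sub, blk_sub]
  linarith

theorem hasDerivAt_gsum_line (hA : Assumption g h P) (x v : XVec V M) :
    HasDerivAt (fun t : ℝ => gsum g (x + t • v)) (gradStack g x ⬝ᵥ v) 0 := by
  rw [← sum_inner_gradient]
  have := HasDerivAt.fun_sum (u := Finset.univ) fun i _ =>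
    hasDerivAt_comp_line (hA.g_diff i) (blk x i) (blk v i) 0
  simp only [zero_smul, add_zero] at this
  exact this

/-- First-order condition for minimizing the sum of `h` and a function that is differentiable
along the segment to `u`. -/
theorem first_order_condition (hA : Assumption g h P) {x u : XVec V M} (hx : x ∈ domH h)
    (hu : u ∈ domH h) {φ : ℝ → ℝ} {d : ℝ} (hφ : HasDerivAt φ d 0)
    (hmin : ∀ t : ℝ, x + t • (u - x) ∈ domH h →
      φ 0 + hsum h x ≤ φ t + hsum h (x + t • (u - x))) :
    0 ≤ hsum h u - hsum h x + d := by
  have := nonneg_of_le_add_mul (c := hsum h u - hsum h x) hφ fun t ht0 ht1 => by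
    have e : (1 - t) • x + t • u = x + t • (u - x) := by module
    have h1 := (convexOn_hsum hA).2 hx hu (sub_nonneg.2 ht1) ht0.le (by ring)
    have h2 := hmin t (e ▸ convex_domH hA hx hu (sub_nonneg.2 ht1) ht0.le (by ring))
    rw [e] at h1
    simp only [smul_eq_mul] at h1
    linarith
  linarith

end Objective

section Algorithm

variable {V : Type*} [Fintype V] [DecidableEq V] {G : SimpleGraph V} [DecidableRel G.Adj] {M : ℕ}

/-! ### The iteration -/

theorem Gam_transpose (rho : V → V → ℝ) : (Gam G M rho)ᵀ = Gam G M rho := by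
  rw [Gam_eq_diagonal, Matrix.diagonal_transpose]

theorem Gam_inv_transpose (rho : V → V → ℝ) : ((Gam G M rho)⁻¹)ᵀ = (Gam G M rho)⁻¹ := by
  rw [Matrix.transpose_nonsing_inv, Gam_transpose]

theorem Gam_mul_inv {rho : V → V → ℝ} (hrho : ∀ i j, G.Adj i j → 0 < rho i j) :
    Gam G M rho * (Gam G M rho)⁻¹ = 1 := by
  apply Matrix.mul_nonsing_inv
  rw [Gam_eq_diagonal, Matrix.det_diagonal]
  exact (Finset.prod_pos fun p _ => gam_pos G hrho p).ne'.isUnit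

theorem Gam_inv_mul {rho : V → V → ℝ} (hrho : ∀ i j, G.Adj i j → 0 < rho i j) :
    (Gam G M rho)⁻¹ * Gam G M rho = 1 :=
  _root_.mul_eq_one_comm.1 (Gam_mul_inv hrho)

/-- The vector multiplied by `Bᵀ` is the updated multiplier, so the stationarity condition of the
`z`-update is what keeps all multipliers in the kernel of `Bᵀ`. -/
theorem transpose_B_mulVec_of_isMinOn {rho : V → V → ℝ}
    (hrho : ∀ i j, G.Adj i j → 0 < rho i j) {x : XVec V M} {l : LVec G M} {z : ZVec G M}
    (hz : IsMinOn (zObj G rho x l) Set.univ z) :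
    (B G M)ᵀ *ᵥ (l + Gam G M rho *ᵥ res G x z) = 0 := by
  set a := res G x z + (Gam G M rho)⁻¹ *ᵥ l with ha
  have hGa : Gam G M rho *ᵥ a = l + Gam G M rho *ᵥ res G x z := by
    rw [ha, Matrix.mulVec_add, Matrix.mulVec_mulVec, Gam_mul_inv hrho, Matrix.one_mulVec, add_comm]
  have key : ∀ w : ZVec G M, 0 ≤ a ⬝ᵥ (Gam G M rho *ᵥ (B G M *ᵥ w)) := by
    intro w
    have hd : HasDerivAt (fun t : ℝ => t * (a ⬝ᵥ (Gam G M rho *ᵥ (B G M *ᵥ w)))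
        + t ^ 2 * (1 / 2 * wsq (Gam G M rho) (B G M *ᵥ w)))
        (a ⬝ᵥ (Gam G M rho *ᵥ (B G M *ᵥ w))) 0 := by
      have := ((hasDerivAt_id (0 : ℝ)).mul_const (a ⬝ᵥ (Gam G M rho *ᵥ (B G M *ᵥ w)))).add
        (((hasDerivAt_id (0 : ℝ)).pow 2).mul_const (1 / 2 * wsq (Gam G M rho) (B G M *ᵥ w)))
      refine this.congr_deriv ?_
      simp
    have h1 := nonneg_of_le_add_mul (c := 0) hd fun t _ _ => by
      have h2 : zObj G rho x l z ≤ zObj G rho x l (z + t • w) := hz (Set.mem_univ _)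
      have e : res G x (z + t • w) + (Gam G M rho)⁻¹ *ᵥ l = a + t • (B G M *ᵥ w) := by
        rw [ha, res, res, Matrix.mulVec_add, Matrix.mulVec_smul]; abel
      rw [zObj, zObj, e, ← ha, wsq_add_smul (Gam_transpose rho)] at h2
      simp only [zero_mul, ne_eq, OfNat.ofNat_ne_zero, not_false_eq_true, zero_pow, mul_zero,
        add_zero]
      linarith
    simpa using h1
  have e : ∀ w : ZVec G M, a ⬝ᵥ (Gam G M rho *ᵥ (B G M *ᵥ w))
      = ((B G M)ᵀ *ᵥ (Gam G M rho *ᵥ a)) ⬝ᵥ w := by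
    intro w
    rw [dotProduct_mulVec_comm (Gam_transpose rho), dotProduct_comm, Matrix.dotProduct_mulVec,
      ← Matrix.mulVec_transpose]
  rw [← hGa, ← dotProduct_self_eq_zero]
  -- Directions run over a whole space, so testing both signs of the gradient forces its square norm
  -- to vanish.
  have h1 := key (-((B G M)ᵀ *ᵥ (Gam G M rho *ᵥ a)))
  have h2 := key ((B G M)ᵀ *ᵥ (Gam G M rho *ᵥ a))
  rw [e] at h1 h2
  rw [dotProduct_neg] at h1
  linarith

theorem dotProduct_res_eq {l : LVec G M} (hl : (B G M)ᵀ *ᵥ l = 0) (x : XVec V M) (z : ZVec G M) :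
    l ⬝ᵥ res G x z = l ⬝ᵥ (A G M *ᵥ x) := by
  rw [res, dotProduct_add, Matrix.dotProduct_mulVec l (B G M), ← Matrix.mulVec_transpose, hl,
    zero_dotProduct, add_zero]

variable {rho : V → V → ℝ} {ω : V → ℝ} {g : V → EuclideanSpace ℝ (Fin M) → ℝ}
  {h : V → EuclideanSpace ℝ (Fin M) → EReal} {P : V → ℝ}
  {x : ℕ → XVec V M} {z : ℕ → ZVec G M} {lam : ℕ → LVec G M}

theorem IsPGC.transpose_B_mulVec_lam (hrho : ∀ i j, G.Adj i j → 0 < rho i j)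
    (hw : IsPGC G rho ω g h x z lam) (r : ℕ) : (B G M)ᵀ *ᵥ lam r = 0 := by
  cases r with
  | zero => exact hw.init_lam
  | succ r => rw [hw.lam_step]; exact transpose_B_mulVec_of_isMinOn hrho (hw.z_min r)

/-- Consecutive multipliers both lie in the kernel of `Bᵀ`, hence so does their difference `Γ (A x +
B z)`. On each arc this says that the two residuals cancel. -/
theorem IsPGC.z_eq (hrho : ∀ i j, G.Adj i j → 0 < rho i j)
    (hw : IsPGC G rho ω g h x z lam) (r : ℕ) :
    z r = (1 / 2 : ℝ) • ((Mplus G M)ᵀ *ᵥ x r) := by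
  cases r with
  | zero => exact hw.init_z
  | succ r =>
    have h1 := hw.transpose_B_mulVec_lam hrho (r + 1)
    rw [hw.lam_step, Matrix.mulVec_add, hw.transpose_B_mulVec_lam hrho r, zero_add] at h1
    ext q
    have h2 := congrFun h1 q
    rw [B_transpose_mulVec, Gam_eq_diagonal, Matrix.mulVec_diagonal, Matrix.mulVec_diagonal,
      res_inl, res_inr, gam, Sum.elim_inl, Sum.elim_inr, Pi.zero_apply] at h2
    rw [Pi.smul_apply, Mplus_transpose_mulVec, smul_eq_mul]
    have h3 := hrho _ _ q.1.adj
    have h4 : rho q.1.fst q.1.snd * (x (r + 1) (q.1.fst, q.2) + x (r + 1) (q.1.snd, q.2)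
        - 2 * z (r + 1) q) = 0 := by linarith
    rcases mul_eq_zero.1 h4 with h5 | h5
    · exact absurd h5 h3.ne'
    · linarith

theorem B_mulVec_dotProduct_Gam (rho : V → V → ℝ) (w : ZVec G M) (v : XVec V M) :
    (B G M *ᵥ w) ⬝ᵥ (Gam G M rho *ᵥ (A G M *ᵥ v))
      = -(w ⬝ᵥ (XiI G M rho *ᵥ ((Mplus G M)ᵀ *ᵥ v))) := by
  rw [Gam_eq_diagonal, XiI_eq_diagonal]
  simp only [dotProduct, Matrix.mulVec_diagonal, Fintype.sum_sum_type, B_mulVec_inl,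
    B_mulVec_inr, A_mulVec_inl, A_mulVec_inr, Mplus_transpose_mulVec, gam, Sum.elim_inl,
    Sum.elim_inr]
  rw [← Finset.sum_add_distrib, ← Finset.sum_neg_distrib]
  exact Finset.sum_congr rfl fun q _ => by ring

/-- The variational inequality solved by the `x`-update. -/
theorem IsPGC.variational_inequality (hA : Assumption g h P)
    (hrho : ∀ i j, G.Adj i j → 0 < rho i j)
    (hw : IsPGC G rho ω g h x z lam) (r : ℕ) {u : XVec V M} (hu : u ∈ domH h) :
    0 ≤ hsum h u - hsum h (x (r + 1)) + (gradStack g (x r) ⬝ᵥ (u - x (r + 1))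
      + lam (r + 1) ⬝ᵥ (A G M *ᵥ (u - x (r + 1)))
      + (x (r + 1) - x r) ⬝ᵥ (proxMetric G M rho ω *ᵥ (u - x (r + 1)))) := by
  set v := u - x (r + 1) with hv
  set y := x (r + 1) with hy
  have hΩ : (diagI M ω)ᵀ = diagI M ω := by rw [diagI_eq_diagonal, Matrix.diagonal_transpose]
  have hd : HasDerivAt (fun t : ℝ => t * (gradStack g (x r) ⬝ᵥ v + lam r ⬝ᵥ (A G M *ᵥ v)
      + res G y (z r) ⬝ᵥ (Gam G M rho *ᵥ (A G M *ᵥ v)) + (y - x r) ⬝ᵥ (diagI M ω *ᵥ v))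
      + t ^ 2 * (1 / 2 * wsq (Gam G M rho) (A G M *ᵥ v) + 1 / 2 * wsq (diagI M ω) v))
      (gradStack g (x r) ⬝ᵥ v + lam r ⬝ᵥ (A G M *ᵥ v)
      + res G y (z r) ⬝ᵥ (Gam G M rho *ᵥ (A G M *ᵥ v)) + (y - x r) ⬝ᵥ (diagI M ω *ᵥ v)) 0 := by
    have := ((hasDerivAt_id (0 : ℝ)).mul_const (gradStack g (x r) ⬝ᵥ v
      + lam r ⬝ᵥ (A G M *ᵥ v) + res G y (z r) ⬝ᵥ (Gam G M rho *ᵥ (A G M *ᵥ v))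
      + (y - x r) ⬝ᵥ (diagI M ω *ᵥ v))).add
      (((hasDerivAt_id (0 : ℝ)).pow 2).mul_const
        (1 / 2 * wsq (Gam G M rho) (A G M *ᵥ v) + 1 / 2 * wsq (diagI M ω) v))
    refine this.congr_deriv ?_
    simp
  have h1 := first_order_condition hA (hw.x_mem r) hu hd fun t ht => by
    have h2 := hw.x_min r ht
    simp only [Set.mem_ofPred_eq] at h2
    rw [← hv, ← hy] at h2 ⊢
    have e1 : res G (y + t • v) (z r) = res G y (z r) + t • (A G M *ᵥ v) := by
      rw [res, res, Matrix.mulVec_add, Matrix.mulVec_smul]; abel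
    have e2 : y + t • v - x r = (y - x r) + t • v := by abel
    rw [xObj, xObj, e1, e2, wsq_add_smul (Gam_transpose rho), wsq_add_smul hΩ, dotProduct_add,
      dotProduct_add, dotProduct_smul, dotProduct_smul, smul_eq_mul, smul_eq_mul] at h2
    simp only [hsum]
    linarith
  -- Exchanging the old `z` for the new one produces the new multiplier. The correction, through `z
  -- = ½ M₊ᵀ x`, becomes the graph part of the proximal metric.
  have e3 : res G y (z r) = res G y (z (r + 1)) + B G M *ᵥ (z r - z (r + 1)) := by
    rw [res, res, Matrix.mulVec_sub]; abel
  have e4 : z r - z (r + 1) = -((1 / 2 : ℝ) • ((Mplus G M)ᵀ *ᵥ (y - x r))) := by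
    rw [hw.z_eq hrho, hw.z_eq hrho, ← hy, Matrix.mulVec_sub, smul_sub]; abel
  have e5 : res G y (z (r + 1)) ⬝ᵥ (Gam G M rho *ᵥ (A G M *ᵥ v))
      = (Gam G M rho *ᵥ res G y (z (r + 1))) ⬝ᵥ (A G M *ᵥ v) := by
    rw [dotProduct_mulVec_comm (Gam_transpose rho), dotProduct_comm]
  rw [e3, add_dotProduct, B_mulVec_dotProduct_Gam, e4, e5, neg_dotProduct, smul_dotProduct,
    smul_eq_mul] at h1
  rw [dotProduct_proxMetric_mulVec, hw.lam_step, add_dotProduct, ← hy]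
  linarith

/-- The multiplier step, tested against a multiplier `l`. -/
theorem IsPGC.dotProduct_res (hrho : ∀ i j, G.Adj i j → 0 < rho i j)
    (hw : IsPGC G rho ω g h x z lam) (r : ℕ) (l : LVec G M) :
    (l - lam (r + 1)) ⬝ᵥ res G (x (r + 1)) (z (r + 1))
      = 1 / 2 * (wsq (Gam G M rho)⁻¹ (lam r - l) - wsq (Gam G M rho)⁻¹ (lam (r + 1) - l)
        - wsq (Gam G M rho)⁻¹ (lam (r + 1) - lam r)) := by
  rw [← dotProduct_mulVec_sub_sub (Gam_inv_transpose rho),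
    dotProduct_mulVec_comm (Gam_inv_transpose rho)]
  congr 1
  rw [hw.lam_step, add_sub_cancel_left, Matrix.mulVec_mulVec, Gam_inv_mul hrho, Matrix.one_mulVec]

end Algorithm

section Rate

variable {V : Type*} [Fintype V] [DecidableEq V] {G : SimpleGraph V} [DecidableRel G.Adj] {M : ℕ}
  {rho : V → V → ℝ} {ω : V → ℝ} {g : V → EuclideanSpace ℝ (Fin M) → ℝ}
  {h : V → EuclideanSpace ℝ (Fin M) → EReal} {P : V → ℝ}
  {x : ℕ → XVec V M} {z : ℕ → ZVec G M} {lam : ℕ → LVec G M}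

/-! ### The ergodic rate -/

theorem IsPGC.mulVec_dotProduct_sub (hrho : ∀ i j, G.Adj i j → 0 < rho i j)
    (hw : IsPGC G rho ω g h x z lam) (r : ℕ) {u : XVec V M} {w : ZVec G M}
    (huw : res G u w = 0) :
    lam (r + 1) ⬝ᵥ (A G M *ᵥ (u - x (r + 1)))
      = -(lam (r + 1) ⬝ᵥ res G (x (r + 1)) (z (r + 1))) := by
  have hB := hw.transpose_B_mulVec_lam hrho (r + 1)
  have h1 := dotProduct_res_eq hB u w
  rw [huw, dotProduct_zero] at h1
  rw [Matrix.mulVec_sub, dotProduct_sub, ← h1, dotProduct_res_eq hB, zero_sub]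

/-- The linearization of `g` at the old iterate is compared with `g` at the new iterate by the
descent lemma and with `g` at `u` by convexity. The descent lemma is why the old iterate has to lie
in the domain. -/
theorem IsPGC.objective_le (hA : Assumption g h P)
    (hrho : ∀ i j, G.Adj i j → 0 < rho i j)
    (hw : IsPGC G rho ω g h x z lam) {r : ℕ} (hx : x r ∈ domH h) {u : XVec V M}
    (hu : u ∈ domH h) :
    f g h (x (r + 1)) ≤ f g h u + lam (r + 1) ⬝ᵥ (A G M *ᵥ (u - x (r + 1)))
      + (x (r + 1) - x r) ⬝ᵥ (proxMetric G M rho ω *ᵥ (u - x (r + 1)))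
      + 1 / 2 * wsq (diagI M P) (x (r + 1) - x r) := by
  have h1 := hw.variational_inequality hA hrho r hu
  have h2 := gsum_le_add hA hx (hw.x_mem r)
  have h3 := gsum_add_le hA (x r) u
  have h5 : gradStack g (x r) ⬝ᵥ (u - x (r + 1))
      = gradStack g (x r) ⬝ᵥ (u - x r) - gradStack g (x r) ⬝ᵥ (x (r + 1) - x r) := by
    rw [← dotProduct_sub]; congr 1; abel
  rw [h5] at h1
  rw [f_eq, f_eq]
  linarith

theorem IsPGC.descent (hA : Assumption g h P)
    (hrho : ∀ i j, G.Adj i j → 0 < rho i j)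
    (hw : IsPGC G rho ω g h x z lam) {r : ℕ} (hx : x r ∈ domH h) {u : XVec V M} {w : ZVec G M}
    (hu : u ∈ domH h) (huw : res G u w = 0) (l : LVec G M) :
    f g h (x (r + 1)) - f g h u + l ⬝ᵥ res G (x (r + 1)) (z (r + 1))
      ≤ 1 / 2 * (wsq (proxMetric G M rho ω) (x r - u) + wsq (Gam G M rho)⁻¹ (lam r - l))
        - 1 / 2 * (wsq (proxMetric G M rho ω) (x (r + 1) - u)
          + wsq (Gam G M rho)⁻¹ (lam (r + 1) - l))
        - 1 / 2 * (wsq (proxMetric G M rho ω - diagI M P) (x (r + 1) - x r)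
          + wsq (Gam G M rho)⁻¹ (lam (r + 1) - lam r)) := by
  have h1 := hw.objective_le hA hrho hx hu
  rw [hw.mulVec_dotProduct_sub hrho r huw,
    dotProduct_mulVec_sub_sub (proxMetric_transpose G rho ω)] at h1
  have h4 := hw.dotProduct_res hrho r l
  rw [sub_dotProduct] at h4
  rw [wsq_sub_matrix]
  linarith

theorem IsPGC.sum_le (hA : Assumption g h P)
    (hrho : ∀ i j, G.Adj i j → 0 < rho i j)
    (hw : IsPGC G rho ω g h x z lam) (hx : x 0 ∈ domH h) {u : XVec V M} {w : ZVec G M}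
    (hu : u ∈ domH h) (huw : res G u w = 0)
    (hD : (proxMetric G M rho ω - diagI M P).PosDef)
    (hΓ : ((Gam G M rho)⁻¹).PosDef) (l : LVec G M) (r : ℕ) :
    ∑ t ∈ Finset.Icc 1 r, (f g h (x t) - f g h u + l ⬝ᵥ res G (x t) (z t))
      ≤ 1 / 2 * (wsq (proxMetric G M rho ω) (x 0 - u) + wsq (Gam G M rho)⁻¹ (lam 0 - l))
        - 1 / 2 * (wsq (proxMetric G M rho ω) (x r - u) + wsq (Gam G M rho)⁻¹ (lam r - l)) := by
  induction r with
  | zero => simp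
  | succ r ih =>
    rw [Finset.sum_Icc_succ_top (by omega)]
    have hxr : x r ∈ domH h := by
      cases r with
      | zero => exact hx
      | succ r => exact hw.x_mem r
    have h1 := hw.descent hA hrho hxr hu huw l
    have h2 := wsq_nonneg hD (x (r + 1) - x r)
    have h3 := wsq_nonneg hΓ (lam (r + 1) - lam r)
    linarith

theorem posDef_Gam_inv (hrho : ∀ i j, G.Adj i j → 0 < rho i j) :
    ((Gam G M rho)⁻¹).PosDef := by
  rw [Gam_inv_eq_diagonal G hrho]
  exact Matrix.PosDef.diagonal fun p => inv_pos.2 (gam_pos G hrho p)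

theorem posDef_diagI {c : V → ℝ} (hc : ∀ i, 0 < c i) : (diagI M c).PosDef := by
  rw [diagI_eq_diagonal]
  exact Matrix.PosDef.diagonal fun p => hc p.1

theorem mulVec_avg {ι κ : Type*} [Fintype ι] (Q : Matrix κ ι ℝ) (u : ℕ → ι → ℝ) (r : ℕ) :
    Q *ᵥ avg u r = avg (fun t => Q *ᵥ u t) r := by
  rw [avg, avg, Matrix.mulVec_smul, Matrix.mulVec_sum]

theorem res_avg (x : ℕ → XVec V M) (z : ℕ → ZVec G M) (r : ℕ) :
    res G (avg x r) (avg z r) = avg (fun t => res G (x t) (z t)) r := by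
  rw [res, mulVec_avg, mulVec_avg, avg, avg, avg, ← smul_add, ← Finset.sum_add_distrib]
  rfl

theorem avg_mem {C : Set (XVec V M)} (hC : Convex ℝ C) {r : ℕ} (hr : 0 < r)
    (hx : ∀ t ∈ Finset.Icc 1 r, x t ∈ C) : avg x r ∈ C := by
  have hr' : (r : ℝ) ≠ 0 := by positivity
  rw [avg, Finset.smul_sum]
  exact hC.sum_mem (fun _ _ => by positivity) (by simp [hr']) hx

theorem map_avg_le {C : Set (XVec V M)} {F : XVec V M → ℝ} (hF : ConvexOn ℝ C F) {r : ℕ}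
    (hr : 0 < r) (hx : ∀ t ∈ Finset.Icc 1 r, x t ∈ C) :
    F (avg x r) ≤ 1 / (r : ℝ) * ∑ t ∈ Finset.Icc 1 r, F (x t) := by
  have hr' : (r : ℝ) ≠ 0 := by positivity
  rw [avg, Finset.smul_sum, Finset.mul_sum]
  exact hF.map_sum_le (fun _ _ => by positivity) (by simp [hr']) hx

theorem euclNorm_nonneg {ι : Type*} [Fintype ι] (v : ι → ℝ) : 0 ≤ euclNorm v := norm_nonneg _

theorem dotProduct_self_eq_euclNorm_sq {ι : Type*} [Fintype ι] (v : ι → ℝ) :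
    v ⬝ᵥ v = euclNorm v ^ 2 := by
  rw [euclNorm_sq, dotProduct]
  exact Finset.sum_congr rfl fun i _ => (sq (v i)).symm

theorem euclNorm_smul {ι : Type*} [Fintype ι] (c : ℝ) (v : ι → ℝ) :
    euclNorm (c • v) = |c| * euclNorm v := by
  rw [euclNorm, WithLp.toLp_smul, norm_smul, Real.norm_eq_abs, euclNorm]

/-- A real `sSup` dominates its members only if the set is bounded above, so an explicit upper bound
has to be exhibited first; the same applies to `dz` and `dx`. -/
theorem wsq_le_dlam_sq (hrho : ∀ i j, G.Adj i j → 0 < rho i j) {lam0 l : LVec G M} {R : ℝ}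
    (hl : euclNorm l ≤ R) : wsq (Gam G M rho)⁻¹ (lam0 - l) ≤ dlam G rho lam0 R ^ 2 := by
  have hle : √(wsq (Gam G M rho)⁻¹ (l - lam0)) ≤ dlam G rho lam0 R := by
    refine le_csSup ⟨√(∑ p, (gam G rho M p)⁻¹ * (R + |lam0 p|) ^ 2), ?_⟩ ⟨l, hl, rfl⟩
    rintro d ⟨m, hm, rfl⟩
    refine Real.sqrt_le_sqrt ?_
    rw [Gam_inv_eq_diagonal G hrho, wsq_diagonal]
    refine Finset.sum_le_sum fun p _ =>
      mul_le_mul_of_nonneg_left ?_ (inv_pos.2 (gam_pos G hrho p)).le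
    have h1 : |m p| ≤ R :=
      (PiLp.norm_apply_le (WithLp.toLp 2 m : EuclideanSpace ℝ _) p).trans hm
    rw [← sq_abs, Pi.sub_apply]
    gcongr
    exact (abs_sub _ _).trans (by gcongr)
  rw [← wsq_neg, neg_sub, ← Real.sq_sqrt (wsq_nonneg (posDef_Gam_inv hrho) (l - lam0))]
  exact pow_le_pow_left₀ (Real.sqrt_nonneg _) hle 2

theorem exists_norm_blk_le (hb : Bornology.IsBounded (domH h)) :
    ∃ K, 0 ≤ K ∧ ∀ u ∈ domH h, ∀ i, ‖blk u i‖ ≤ K := by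
  obtain ⟨C, hC⟩ := hb.exists_norm_le
  refine ⟨√(∑ _k : Fin M, C ^ 2), Real.sqrt_nonneg _, fun u hu i => ?_⟩
  refine Real.le_sqrt_of_sq_le ?_
  rw [norm_blk_sq]
  refine Finset.sum_le_sum fun k _ => ?_
  rw [← sq_abs]
  exact pow_le_pow_left₀ (abs_nonneg _) ((norm_le_pi_norm u (i, k)).trans (hC u hu)) 2

theorem sum_le_dz_sq (hrho : ∀ i j, G.Adj i j → 0 < rho i j)
    (hb : Bornology.IsBounded (domH h)) {u v : XVec V M} (hu : u ∈ domH h) (hv : v ∈ domH h) :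
    ∑ e : G.Dart, 2 * rho e.fst e.snd * ‖blk u e.fst - blk v e.snd‖ ^ 2 ≤ dz G rho h ^ 2 := by
  obtain ⟨K, hK0, hK⟩ := exists_norm_blk_le hb
  have hle : √(∑ e : G.Dart, 2 * rho e.fst e.snd * ‖blk u e.fst - blk v e.snd‖ ^ 2)
      ≤ dz G rho h := by
    refine le_csSup ⟨√(∑ e : G.Dart, 2 * rho e.fst e.snd * (K + K) ^ 2), ?_⟩ ⟨u, hu, v, hv, rfl⟩
    rintro d ⟨a, ha, b, hb, rfl⟩
    refine Real.sqrt_le_sqrt (Finset.sum_le_sum fun e _ => ?_)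
    have := hrho _ _ e.adj
    gcongr
    exact (norm_sub_le _ _).trans (add_le_add (hK a ha _) (hK b hb _))
  have h0 : 0 ≤ ∑ e : G.Dart, 2 * rho e.fst e.snd * ‖blk u e.fst - blk v e.snd‖ ^ 2 :=
    Finset.sum_nonneg fun e _ => by have := hrho _ _ e.adj; positivity
  rw [← Real.sq_sqrt h0]
  exact pow_le_pow_left₀ (Real.sqrt_nonneg _) hle 2

theorem sum_norm_sq_le_dx_sq (hb : Bornology.IsBounded (domH h)) {u v : XVec V M}
    (hu : u ∈ domH h) (hv : v ∈ domH h) : ∑ i, ‖blk (u - v) i‖ ^ 2 ≤ dx h ^ 2 := by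
  obtain ⟨K, hK0, hK⟩ := exists_norm_blk_le hb
  have hsq : ∀ a : XVec V M, euclNorm a ^ 2 = ∑ i, ‖blk a i‖ ^ 2 := fun a => by
    rw [euclNorm_sq, Fintype.sum_prod_type]
    exact Finset.sum_congr rfl fun i _ => (norm_blk_sq a i).symm
  have hle : euclNorm (u - v) ≤ dx h := by
    refine le_csSup ⟨√(∑ _i : V, (K + K) ^ 2), ?_⟩ ⟨u, hu, v, hv, rfl⟩
    rintro d ⟨a, ha, b, hb, rfl⟩
    refine Real.le_sqrt_of_sq_le ?_
    rw [hsq]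
    refine Finset.sum_le_sum fun i _ => ?_
    rw [blk_sub]
    gcongr
    exact (norm_sub_le _ _).trans (add_le_add (hK a ha _) (hK b hb _))
  rw [← hsq]
  exact pow_le_pow_left₀ (euclNorm_nonneg _) hle 2

/-- With `a = u - v`, use `‖a_i + a_j‖² ≤ 2‖a_i‖² + 2‖a_j‖²`. Since `v` is constant across each arc,
`a_i = u_i - v_j` and `a_j = u_j - v_i`. The two resulting sums, for the pairs `(u, v)` and `(v,
u)`, are each at most `dz²`, and the factor `½` in the metric absorbs their number. -/
theorem wsq_proxMetric_le [Nonempty V] (hrho : ∀ i j, G.Adj i j → 0 < rho i j)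
    (hω : ∀ i, 0 ≤ ω i)
    (hb : Bornology.IsBounded (domH h)) {u v : XVec V M} (hu : u ∈ domH h) (hv : v ∈ domH h)
    {w : ZVec G M} (hvw : res G v w = 0) :
    wsq (proxMetric G M rho ω) (u - v) ≤ dz G rho h ^ 2 + (⨆ i, ω i) * dx h ^ 2 := by
  have h1 : wsq (diagI M ω) (u - v) ≤ (⨆ i, ω i) * dx h ^ 2 := by
    have hsup : ∀ i, ω i ≤ ⨆ i, ω i := fun i => le_ciSup (Set.finite_range ω).bddAbove i
    rw [wsq_diagI]
    calc ∑ i, ω i * ‖blk (u - v) i‖ ^ 2 ≤ ∑ i, (⨆ i, ω i) * ‖blk (u - v) i‖ ^ 2 :=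
          Finset.sum_le_sum fun i _ => mul_le_mul_of_nonneg_right (hsup i) (sq_nonneg _)
      _ = (⨆ i, ω i) * ∑ i, ‖blk (u - v) i‖ ^ 2 := by rw [Finset.mul_sum]
      _ ≤ _ := mul_le_mul_of_nonneg_left (sum_norm_sq_le_dx_sq hb hu hv)
          ((hω (Classical.arbitrary V)).trans (hsup _))
  have hcons : ∀ e : G.Dart, blk v e.fst = blk v e.snd := fun e => by
    ext k
    have e1 := congrFun hvw (Sum.inl (e, k))
    have e2 := congrFun hvw (Sum.inr (e, k))
    rw [res_inl, Pi.zero_apply] at e1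
    rw [res_inr, Pi.zero_apply] at e2
    change v (e.fst, k) = v (e.snd, k)
    linarith
  have h2 : 1 / 2 * wsq (XiI G M rho) ((Mplus G M)ᵀ *ᵥ (u - v)) ≤ dz G rho h ^ 2 := by
    have ha := sum_le_dz_sq hrho hb hu hv
    have hb := sum_le_dz_sq hrho hb hv hu
    have hstep : wsq (XiI G M rho) ((Mplus G M)ᵀ *ᵥ (u - v))
        ≤ ∑ e : G.Dart, (2 * rho e.fst e.snd * ‖blk u e.fst - blk v e.snd‖ ^ 2
          + 2 * rho e.fst e.snd * ‖blk v e.fst - blk u e.snd‖ ^ 2) := by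
      rw [XiI_eq_diagonal, wsq_diagonal, Fintype.sum_prod_type]
      refine Finset.sum_le_sum fun e _ => ?_
      have hρ := hrho _ _ e.adj
      have e1 : ‖blk u e.fst - blk v e.snd‖ ^ 2 = ∑ k, (u - v) (e.fst, k) ^ 2 := by
        rw [← hcons e, ← blk_sub, norm_blk_sq]
      have e2 : ‖blk v e.fst - blk u e.snd‖ ^ 2 = ∑ k, (u - v) (e.snd, k) ^ 2 := by
        rw [hcons e, norm_sub_rev, ← blk_sub, norm_blk_sq]
      rw [e1, e2, Finset.mul_sum, Finset.mul_sum, ← Finset.sum_add_distrib]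
      refine Finset.sum_le_sum fun k _ => ?_
      rw [Mplus_transpose_mulVec]
      nlinarith [mul_nonneg hρ.le (sq_nonneg ((u - v) (e.fst, k) - (u - v) (e.snd, k)))]
    rw [Finset.sum_add_distrib] at hstep
    linarith
  have h3 : wsq (proxMetric G M rho ω) (u - v) = wsq (diagI M ω) (u - v)
      + 1 / 2 * wsq (XiI G M rho) ((Mplus G M)ᵀ *ᵥ (u - v)) :=
    dotProduct_proxMetric_mulVec G rho ω _ _
  linarith

theorem IsPGC.ergodic_rate [Nonempty V] (hA : Assumption g h P)
    (hrho : ∀ i j, G.Adj i j → 0 < rho i j) (hω : ∀ i, 0 ≤ ω i)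
    (hw : IsPGC G rho ω g h x z lam) (hb : Bornology.IsBounded (domH h))
    (hD : (proxMetric G M rho ω - diagI M P).PosDef) (hx : x 0 ∈ domH h)
    {u : XVec V M} {w : ZVec G M} (hu : u ∈ domH h) (huw : res G u w = 0)
    {R : ℝ} (hR : 0 < R) {r : ℕ} (hr : 0 < r) :
    f g h (avg x r) - f g h u + R * euclNorm (res G (avg x r) (avg z r))
      ≤ 1 / (2 * (r : ℝ)) * (dz G rho h ^ 2 + dlam G rho (lam 0) R ^ 2
          + (⨆ i, ω i) * dx h ^ 2) := by
  have hr' : (0 : ℝ) < r := by exact_mod_cast hr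
  set s := res G (avg x r) (avg z r) with hs
  -- The multiplier of norm at most `R` that attains `R ‖s‖`; when `s = 0`, division by zero makes
  -- it `0`, which also works.
  set l := (R / euclNorm s) • s with hl
  have hls : l ⬝ᵥ s = R * euclNorm s := by
    rw [hl, smul_dotProduct, dotProduct_self_eq_euclNorm_sq, smul_eq_mul]
    rcases eq_or_ne (euclNorm s) 0 with h0 | h0
    · simp [h0]
    · field_simp
  have hln : euclNorm l ≤ R := by
    rw [hl, euclNorm_smul, abs_of_nonneg (div_nonneg hR.le (euclNorm_nonneg _))]
    rcases eq_or_ne (euclNorm s) 0 with h0 | h0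
    · simp [h0, hR.le]
    · rw [div_mul_cancel₀ _ h0]
  have hxm : ∀ t ∈ Finset.Icc 1 r, x t ∈ domH h := fun t ht => by
    obtain ⟨k, rfl⟩ := Nat.exists_eq_add_of_le' (Finset.mem_Icc.1 ht).1
    exact hw.x_mem k
  have h1 := hw.sum_le hA hrho hx hu huw hD (posDef_Gam_inv hrho) l r
  have h2 := map_avg_le (convexOn_f hA) hr hxm
  have h3 : l ⬝ᵥ s = 1 / (r : ℝ) * ∑ t ∈ Finset.Icc 1 r, l ⬝ᵥ res G (x t) (z t) := by
    rw [hs, res_avg, avg, dotProduct_smul, dotProduct_sum, smul_eq_mul]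
  have hDm : (proxMetric G M rho ω).PosDef := by
    have := hD.add (posDef_diagI (M := M) hA.P_pos)
    rwa [sub_add_cancel] at this
  have h4 := wsq_nonneg hDm (x r - u)
  have h5 := wsq_nonneg (posDef_Gam_inv (M := M) hrho) (lam r - l)
  have h6 := wsq_proxMetric_le hrho hω hb hx hu huw
  have h7 := wsq_le_dlam_sq hrho (lam0 := lam 0) hln
  rw [Finset.sum_add_distrib, Finset.sum_sub_distrib, Finset.sum_const, Nat.card_Icc,
    Nat.add_sub_cancel, nsmul_eq_mul] at h1
  rw [← hls, h3]
  calc f g h (avg x r) - f g h u + 1 / (r : ℝ) * ∑ t ∈ Finset.Icc 1 r, l ⬝ᵥ res G (x t) (z t)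
      ≤ 1 / (r : ℝ) * ∑ t ∈ Finset.Icc 1 r, f g h (x t) - f g h u
        + 1 / (r : ℝ) * ∑ t ∈ Finset.Icc 1 r, l ⬝ᵥ res G (x t) (z t) := by linarith
    _ = 1 / (r : ℝ) * (∑ t ∈ Finset.Icc 1 r, f g h (x t) - r * f g h u
        + ∑ t ∈ Finset.Icc 1 r, l ⬝ᵥ res G (x t) (z t)) := by field_simp
    _ ≤ 1 / (r : ℝ) * (1 / 2 * (dz G rho h ^ 2 + dlam G rho (lam 0) R ^ 2
          + (⨆ i, ω i) * dx h ^ 2)) := by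
        gcongr
        linarith
    _ = _ := by field_simp

end Rate

end PGC

/-! ### Existence of a saddle point -/

/-- The line through `y` and `c` stays in the affine span, where `C` is a neighbourhood of `c`;
hence the segment from `y` can be prolonged beyond `c`. -/
theorem exists_sub_smul_mem_of_mem_intrinsicInterior {E : Type*} [NormedAddCommGroup E]
    [NormedSpace ℝ E] {C : Set E} {c y : E} (hc : c ∈ intrinsicInterior ℝ C) (hy : y ∈ C) :
    ∃ ε : ℝ, 0 < ε ∧ ∀ t, 0 ≤ t → t < ε → c - t • (y - c) ∈ C := by
  obtain ⟨c', hc', rfl⟩ := mem_intrinsicInterior.1 hc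
  have hmem : ∀ t : ℝ, (c' : E) - t • (y - c') ∈ affineSpan ℝ C := fun t => by
    have := AffineMap.lineMap_mem (-t) c'.2 (subset_affineSpan ℝ C hy)
    rw [AffineMap.lineMap_apply_module'] at this
    convert this using 1
    module
  have hcont : Continuous fun t : ℝ => (⟨(c' : E) - t • (y - c'), hmem t⟩ : affineSpan ℝ C) :=
    Continuous.subtype_mk (by fun_prop) _
  have h0 : (⟨(c' : E) - (0 : ℝ) • (y - c'), hmem 0⟩ : affineSpan ℝ C) = c' := by
    ext; simp
  have hnhds := hcont.continuousAt.preimage_mem_nhds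
    (t := (Subtype.val ⁻¹' C : Set (affineSpan ℝ C))) (x := 0) (by
      rw [h0]; exact mem_interior_iff_mem_nhds.1 hc')
  obtain ⟨ε, hε, hball⟩ := Metric.mem_nhds_iff.1 hnhds
  refine ⟨ε, hε, fun t ht0 ht1 => ?_⟩
  exact hball (by rw [Metric.mem_ball, Real.dist_eq, sub_zero, abs_of_nonneg ht0]; exact ht1)

namespace PGC

section Saddle

variable {V : Type*} [Fintype V] [DecidableEq V] {G : SimpleGraph V} [DecidableRel G.Adj] {M : ℕ}
  {g : V → EuclideanSpace ℝ (Fin M) → ℝ}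
  {h : V → EuclideanSpace ℝ (Fin M) → EReal} {P : V → ℝ}

/-- The stacked vector whose blocks all equal `y`. -/
def consensus (V : Type*) {M : ℕ} (y : EuclideanSpace ℝ (Fin M)) : XVec V M := fun p => y p.2

theorem blk_consensus (y : EuclideanSpace ℝ (Fin M)) (i : V) : blk (consensus V y) i = y := rfl

theorem res_consensus (y : EuclideanSpace ℝ (Fin M)) :
    res G (consensus V y) (fun q => y q.2) = 0 := by
  ext p
  rcases p with q | q
  · rw [res_inl]; simp [consensus]
  · rw [res_inr]; simp [consensus]

theorem blk_eq_of_res_eq_zero (hG : G.Connected) {x : XVec V M} {z : ZVec G M}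
    (hres : res G x z = 0) (i j : V) : blk x i = blk x j := by
  obtain ⟨p⟩ := hG.preconnected i j
  induction p with
  | nil => rfl
  | @cons a b c hab p ih =>
    refine Eq.trans ?_ ih
    ext k
    have e1 := congrFun hres (Sum.inl (⟨(a, b), hab⟩, k))
    have e2 := congrFun hres (Sum.inr (⟨(a, b), hab⟩, k))
    rw [res_inl, Pi.zero_apply] at e1
    rw [res_inr, Pi.zero_apply] at e2
    change x (a, k) = x (b, k)
    linarith

theorem IsConsensusOptimal.isPrimalOptimal (hG : G.Connected) {y : EuclideanSpace ℝ (Fin M)}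
    (hy : IsConsensusOptimal g h y) :
    IsPrimalOptimal G g h (consensus V y) (fun q => y q.2) := by
  refine ⟨hy.1, res_consensus y, fun x' hx' z' hres => ?_⟩
  have hb := fun i => blk_eq_of_res_eq_zero hG hres i hG.nonempty.some
  have h1 := hy.2 (blk x' hG.nonempty.some) fun i => by
    rw [← hb i]; exact hx' i
  simp only [f, hb, blk_consensus]
  exact h1

theorem exists_reflection_mem {c : EuclideanSpace ℝ (Fin M)}
    (hc : ∀ i, c ∈ intrinsicInterior ℝ (edom (h i))) {x : XVec V M} (hx : x ∈ domH h) :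
    ∃ ε : ℝ, 0 < ε ∧ consensus V c - ε • (x - consensus V c) ∈ domH h := by
  choose ε hε hmem using fun i => exists_sub_smul_mem_of_mem_intrinsicInterior (hc i) (hx i)
  rcases isEmpty_or_nonempty V with hV | hV
  · exact ⟨1, one_pos, fun i => hV.elim i⟩
  · obtain ⟨j, hj⟩ := Finite.exists_min ε
    refine ⟨ε j / 2, half_pos (hε j), fun i => ?_⟩
    exact hmem i _ (half_pos (hε j)).le ((half_lt_self (hε j)).trans_le (hj i))

/-- Convexity in homogeneous form: it makes the cones of scaled points below closed under addition.
-/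
theorem combine_mem_le (hA : Assumption g h P) {a b : ℝ} (ha : 0 < a) (hb : 0 < b)
    {x y : XVec V M} (hx : x ∈ domH h) (hy : y ∈ domH h) :
    ∃ u ∈ domH h, (a + b) • u = a • x + b • y ∧
      (a + b) * f g h u ≤ a * f g h x + b * f g h y := by
  have hab : a + b ≠ 0 := (add_pos ha hb).ne'
  have h1 : 0 ≤ a / (a + b) := by positivity
  have h2 : 0 ≤ b / (a + b) := by positivity
  have h3 : a / (a + b) + b / (a + b) = 1 := by field_simp
  refine ⟨_, convex_domH hA hx hy h1 h2 h3, ?_, ?_⟩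
  · rw [smul_add, smul_smul, smul_smul, mul_div_cancel₀ _ hab, mul_div_cancel₀ _ hab]
  · have h4 := mul_le_mul_of_nonneg_left ((convexOn_f hA).2 hx hy h1 h2 h3) (add_pos ha hb).le
    refine h4.trans_eq ?_
    simp only [smul_eq_mul]
    field_simp

/-- The span of the constraint residuals of points in the domain, described as a cone; it is a
subspace by Slater's condition. -/
def residualSpan (G : SimpleGraph V) [DecidableRel G.Adj] (hA : Assumption g h P)
    {x₀ : XVec V M} (hx₀ : x₀ ∈ domH h) {z₀ : ZVec G M} (h₀ : res G x₀ z₀ = 0) :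
    Submodule ℝ (LVec G M) where
  carrier := {w | ∃ a : ℝ, 0 < a ∧ ∃ x ∈ domH h, ∃ z, w = res G (a • x) z}
  zero_mem' := ⟨1, one_pos, x₀, hx₀, z₀, by rw [one_smul, h₀]⟩
  add_mem' := by
    rintro _ _ ⟨a, ha, x, hx, z, rfl⟩ ⟨b, hb, y, hy, w, rfl⟩
    obtain ⟨u, hu, hsum, -⟩ := combine_mem_le hA ha hb hx hy
    exact ⟨a + b, add_pos ha hb, u, hu, z + w, by rw [hsum, res_add]⟩
  smul_mem' := by
    rintro c _ ⟨a, ha, x, hx, z, rfl⟩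
    rcases lt_trichotomy c 0 with hc | rfl | hc
    -- Reflecting `x` through a consensus Slater point reverses the sign of its residual, because
    -- the consensus part has residual zero.
    · obtain ⟨y, hy⟩ := hA.slater
      obtain ⟨ε, hε, hmem⟩ := exists_reflection_mem hy hx
      refine ⟨-c * a / ε, div_pos (mul_pos (neg_pos.2 hc) ha) hε, _, hmem,
        c • z + (-c * a / ε * (1 + ε)) • (fun q => y q.2), ?_⟩
      have e : (-c * a / ε) • (consensus V y - ε • (x - consensus V y))
          = c • a • x + (-c * a / ε * (1 + ε)) • consensus V y := by
        ext p
        simp only [Pi.smul_apply, Pi.sub_apply, Pi.add_apply, smul_eq_mul]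
        field_simp
        ring
      rw [e, res_add, res_smul, res_smul, res_consensus, smul_zero, add_zero]
    · exact ⟨1, one_pos, x₀, hx₀, z₀, by rw [one_smul, h₀, zero_smul]⟩
    · exact ⟨c * a, mul_pos hc ha, x, hx, c • z, by rw [mul_smul, res_smul]⟩

/-- Lagrange duality under Slater's condition. -/
theorem exists_multiplier (hA : Assumption g h P) {xs : XVec V M} {zs : ZVec G M}
    (hopt : IsPrimalOptimal G g h xs zs) :
    ∃ l : LVec G M, ∀ x ∈ domH h, ∀ z, f g h xs ≤ f g h x + l ⬝ᵥ res G x z := by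
  obtain ⟨hxs, hres, hmin⟩ := hopt
  let D := residualSpan G hA hxs hres
  -- The cone generated by the epigraph of the perturbation problem: residuals paired with upper
  -- bounds for the excess of `f` over its optimal value.
  let K : PointedCone ℝ (D × ℝ) :=
    { carrier := {p | ∃ a : ℝ, 0 < a ∧ ∃ x ∈ domH h, ∃ z, (p.1 : LVec G M) = res G (a • x) z ∧
        a * (f g h x - f g h xs) ≤ p.2}
      zero_mem' := ⟨1, one_pos, xs, hxs, zs, by simp [hres], by simp⟩
      add_mem' := by
        rintro p q ⟨a, ha, x, hx, z, hp1, hp2⟩ ⟨b, hb, y, hy, w, hq1, hq2⟩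
        obtain ⟨u, hu, hsum, hle⟩ := combine_mem_le (g := g) hA ha hb hx hy
        refine ⟨a + b, add_pos ha hb, u, hu, z + w, ?_, ?_⟩
        · rw [hsum, res_add, ← hp1, ← hq1]; rfl
        · rw [Prod.snd_add]; linarith
      smul_mem' := by
        rintro ⟨c, hc⟩ p ⟨a, ha, x, hx, z, hp1, hp2⟩
        rcases hc.eq_or_lt with rfl | hc
        · refine ⟨1, one_pos, xs, hxs, zs, ?_, ?_⟩
          · rw [one_smul, hres]
            change (((0 : ℝ) • p.1 : D) : LVec G M) = 0
            rw [zero_smul]; rfl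
          · change _ ≤ (0 : ℝ) * p.2
            simp
        · refine ⟨c * a, mul_pos hc ha, x, hx, c • z, ?_, ?_⟩
          · rw [mul_smul, res_smul, ← hp1]; rfl
          · change _ ≤ c * p.2
            rw [mul_assoc]
            exact mul_le_mul_of_nonneg_left hp2 hc.le }
  -- The functional `(0, t) ↦ t`. On `K` it is nonnegative precisely because a zero residual cannot
  -- lower the value of `f`.
  let F : (D × ℝ) →ₗ.[ℝ] ℝ :=
    { domain := Submodule.prod ⊥ ⊤
      toFun := (LinearMap.snd ℝ D ℝ).comp (Submodule.subtype _) }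
  obtain ⟨L, hLF, hLK⟩ := riesz_extension K F
    (by
      rintro ⟨⟨d, t⟩, hp⟩ ⟨a, ha, x, hx, z, h1, h2⟩
      have hd : d = 0 := (Submodule.mem_prod.1 hp).1
      change 0 ≤ t
      simp only [hd] at h1 h2
      have h3 : res G x (a⁻¹ • z) = 0 := by
        have : res G (a⁻¹ • a • x) (a⁻¹ • z) = 0 := by
          rw [res_smul, ← h1]
          exact smul_zero _
        rwa [inv_smul_smul₀ ha.ne'] at this
      exact (mul_nonneg ha.le (sub_nonneg.2 (hmin x hx _ h3))).trans h2)
    -- Every vector of `D` is a residual of a scaled domain point, so some vertical shift reaches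
    -- `K`. That such residuals form a subspace is what Slater's condition supplies.
    (by
      rintro ⟨⟨d, a, ha, x, hx, z, hd⟩, t⟩
      refine ⟨⟨(0, a * (f g h x - f g h xs) - t), Submodule.mem_prod.2 ⟨rfl, trivial⟩⟩,
        a, ha, x, hx, z, ?_, ?_⟩
      · simp [hd]
      · simp)
  -- The extension has the form `Λ d + t`, with `Λ` known only on `D`; any linear extension of `Λ`
  -- to all residuals serves as multiplier.
  obtain ⟨Λ, hΛ⟩ := LinearMap.exists_extend (L.comp (LinearMap.inl ℝ D ℝ))
  refine ⟨fun p => Λ (Pi.single p 1), fun x hx z => ?_⟩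
  have hmem : res G x z ∈ D := ⟨1, one_pos, x, hx, z, by rw [one_smul]⟩
  have h1 := hLK (⟨res G x z, hmem⟩, f g h x - f g h xs)
    ⟨1, one_pos, x, hx, z, by rw [one_smul], by rw [one_mul]⟩
  have h2 : ((⟨res G x z, hmem⟩ : D), f g h x - f g h xs)
      = LinearMap.inl ℝ D ℝ ⟨res G x z, hmem⟩ + (0, f g h x - f g h xs) := by simp
  have h3 : L (0, f g h x - f g h xs) = f g h x - f g h xs :=
    hLF ⟨(0, f g h x - f g h xs), Submodule.mem_prod.2 ⟨rfl, trivial⟩⟩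
  have h4 : L (LinearMap.inl ℝ D ℝ ⟨res G x z, hmem⟩) = Λ (res G x z) :=
    (LinearMap.congr_fun hΛ ⟨res G x z, hmem⟩).symm
  have h5 : Λ (res G x z) = (fun p => Λ (Pi.single p 1)) ⬝ᵥ res G x z := by
    rw [LinearMap.pi_apply_eq_sum_univ Λ (res G x z), dotProduct]
    refine Finset.sum_congr rfl fun p _ => ?_
    rw [smul_eq_mul, mul_comm]
    congr 2
    ext q
    simp [Pi.single_apply, eq_comm]
  rw [h2, map_add, h3, h4, h5] at h1
  linarith

theorem transpose_B_mulVec_eq_zero_of_forall_le {xs : XVec V M} {zs : ZVec G M} {l : LVec G M}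
    (hxs : xs ∈ domH h) (hres : res G xs zs = 0)
    (hl : ∀ x ∈ domH h, ∀ z, f g h xs ≤ f g h x + l ⬝ᵥ res G x z) : (B G M)ᵀ *ᵥ l = 0 := by
  -- Moving `z` against `Bᵀ l` would lower the Lagrangian by `‖Bᵀ l‖²`.
  have h1 := hl xs hxs (zs - (B G M)ᵀ *ᵥ l)
  have h2 : res G xs (zs - (B G M)ᵀ *ᵥ l) = -(B G M *ᵥ ((B G M)ᵀ *ᵥ l)) := by
    rw [← zero_sub, ← hres, res, res, Matrix.mulVec_sub]; abel
  have h3 : 0 ≤ ((B G M)ᵀ *ᵥ l) ⬝ᵥ ((B G M)ᵀ *ᵥ l) := dotProduct_self_star_nonneg _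
  rw [h2, dotProduct_neg, Matrix.dotProduct_mulVec, ← Matrix.mulVec_transpose] at h1
  exact dotProduct_self_eq_zero.1 (by linarith)

theorem isPrimalDualOptimal_of_forall_le {xs : XVec V M} {zs : ZVec G M} {l : LVec G M}
    (hxs : xs ∈ domH h) (hres : res G xs zs = 0)
    (hl : ∀ x ∈ domH h, ∀ z, f g h xs ≤ f g h x + l ⬝ᵥ res G x z) :
    IsPrimalDualOptimal G g h xs zs l where
  primal := ⟨hxs, hres, fun x hx z hz => by simpa [hz] using hl x hx z⟩
  saddle_left l' := by simp [lagr, hres]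
  saddle_right x hx z := by simpa [lagr, hres] using hl x hx z

end Saddle

section Convergence

open Filter Topology

variable {V : Type*} [Fintype V] [DecidableEq V] {G : SimpleGraph V} [DecidableRel G.Adj] {M : ℕ}
  {rho : V → V → ℝ} {ω : V → ℝ} {g : V → EuclideanSpace ℝ (Fin M) → ℝ}
  {h : V → EuclideanSpace ℝ (Fin M) → EReal} {P : V → ℝ}
  {x : ℕ → XVec V M} {z : ℕ → ZVec G M} {lam : ℕ → LVec G M}

/-! ### Convergence of the iterates -/

/-- Lower semicontinuity of the separable sum, expressed in real numbers. Any reals strictly below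
the values `h_i` at the limit are eventually below those along the sequence, so their sum is at most
`β`. An infinite value would allow this sum to exceed `β`. -/
theorem mem_domH_and_hsum_le_of_tendsto (hA : Assumption g h P) {y : ℕ → XVec V M}
    {a : XVec V M} {b : ℕ → ℝ} {β : ℝ} (hy : Tendsto y atTop (𝓝 a)) (hb : Tendsto b atTop (𝓝 β))
    (hmem : ∀ n, y n ∈ domH h) (hle : ∀ n, hsum h (y n) ≤ b n) :
    a ∈ domH h ∧ hsum h a ≤ β := by
  have key : ∀ c : V → ℝ, (∀ i, (c i : EReal) < h i (blk a i)) → ∑ i, c i ≤ β := by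
    intro c hc
    refine ge_of_tendsto hb ?_
    have hev : ∀ᶠ n in atTop, ∀ i, (c i : EReal) < h i (blk (y n) i) := by
      rw [eventually_all]
      intro i
      exact (((continuous_blk i).tendsto a).comp hy).eventually ((hA.h_closed i).lsc _ _ (hc i))
    filter_upwards [hev] with n hn
    refine (Finset.sum_le_sum fun i _ => ?_).trans (hle n)
    have h1 := hn i
    rw [← EReal.coe_toReal (hmem n i) ((hA.h_closed i).ne_bot _)] at h1
    exact (EReal.coe_lt_coe_iff.1 h1).le
  have hexists : ∀ i, ∃ q : ℝ, (q : EReal) < h i (blk a i) := fun i => by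
    obtain ⟨q, -, hq⟩ := EReal.lt_iff_exists_real_btwn.1
      (bot_lt_iff_ne_bot.2 ((hA.h_closed i).ne_bot (blk a i)))
    exact ⟨q, hq⟩
  choose c₀ hc₀ using hexists
  have hdom : a ∈ domH h := by
    intro j hj
    -- The altered entry makes the whole sum equal to `β + 1`.
    have h1 := key (Function.update c₀ j (β + 1 - ∑ i ∈ Finset.univ \ {j}, c₀ i)) fun i => by
      rcases eq_or_ne i j with rfl | hij
      · rw [Function.update_self, hj]; exact EReal.coe_lt_top _
      · rw [Function.update_of_ne hij]; exact hc₀ i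
    rw [Finset.sum_update_of_mem (Finset.mem_univ j)] at h1
    linarith
  refine ⟨hdom, le_of_forall_pos_le_add fun δ hδ => ?_⟩
  have hN : (0 : ℝ) < Fintype.card V + 1 := by positivity
  have h1 := key (fun i => (h i (blk a i)).toReal - δ / (Fintype.card V + 1)) fun i => by
    conv_rhs => rw [← EReal.coe_toReal (hdom i) ((hA.h_closed i).ne_bot _)]
    exact EReal.coe_lt_coe_iff.2 (sub_lt_self _ (by positivity))
  rw [Finset.sum_sub_distrib, Finset.sum_const, Finset.card_univ, nsmul_eq_mul] at h1
  have h2 : (Fintype.card V : ℝ) * (δ / (Fintype.card V + 1)) ≤ δ := by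
    rw [mul_div_assoc', div_le_iff₀ hN]
    nlinarith
  rw [hsum]
  linarith

/-! ### Continuity, and bounds read off from diagonal quadratic forms -/

theorem continuous_gsum (hA : Assumption g h P) : Continuous (gsum g : XVec V M → ℝ) :=
  continuous_finsetSum _ fun i _ => (hA.g_diff i).continuous.comp (continuous_blk i)

theorem continuous_mulVec {ι κ : Type*} [Fintype ι] (Q : Matrix κ ι ℝ) :
    Continuous fun v : ι → ℝ => Q *ᵥ v :=
  continuous_const.matrix_mulVec continuous_id

theorem continuous_wsq {ι : Type*} [Fintype ι] (Q : Matrix ι ι ℝ) : Continuous (wsq Q) :=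
  continuous_id.dotProduct (continuous_mulVec Q)

theorem tendsto_dotProduct {ι : Type*} [Fintype ι] {u v : ℕ → ι → ℝ} {a b : ι → ℝ}
    (hu : Tendsto u atTop (𝓝 a)) (hv : Tendsto v atTop (𝓝 b)) :
    Tendsto (fun n => u n ⬝ᵥ v n) atTop (𝓝 (a ⬝ᵥ b)) :=
  ((continuous_fst.dotProduct continuous_snd).tendsto (a, b)).comp (hu.prodMk_nhds hv)

theorem tendsto_mulVec {ι κ : Type*} [Fintype ι] (Q : Matrix κ ι ℝ) {v : ℕ → ι → ℝ} {b : ι → ℝ}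
    (hv : Tendsto v atTop (𝓝 b)) : Tendsto (fun n => Q *ᵥ v n) atTop (𝓝 (Q *ᵥ b)) :=
  ((continuous_mulVec Q).tendsto b).comp hv

theorem tendsto_wsq {ι : Type*} [Fintype ι] (Q : Matrix ι ι ℝ) {v : ℕ → ι → ℝ} {b : ι → ℝ}
    (hv : Tendsto v atTop (𝓝 b)) : Tendsto (fun n => wsq Q (v n)) atTop (𝓝 (wsq Q b)) :=
  ((continuous_wsq Q).tendsto b).comp hv

theorem abs_le_of_sum_mul_sq_le {ι : Type*} [Fintype ι] {d v : ι → ℝ} (hd : ∀ i, 0 < d i) {K : ℝ}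
    (hK : ∑ i, d i * v i ^ 2 ≤ K) (i : ι) : |v i| ≤ √(K / d i) := by
  rw [← Real.sqrt_sq_eq_abs]
  refine Real.sqrt_le_sqrt ?_
  rw [le_div_iff₀ (hd i), mul_comm]
  exact (Finset.single_le_sum (f := fun i => d i * v i ^ 2)
    (fun j _ => mul_nonneg (hd j).le (sq_nonneg _)) (Finset.mem_univ i)).trans hK

theorem tendsto_of_sum_mul_sq_le {ι : Type*} [Fintype ι] {d : ι → ℝ} (hd : ∀ i, 0 < d i)
    {v : ℕ → ι → ℝ} {a : ι → ℝ} {K : ℕ → ℝ} (hle : ∀ n, ∑ i, d i * (v n - a) i ^ 2 ≤ K n)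
    (hK : Tendsto K atTop (𝓝 0)) : Tendsto v atTop (𝓝 a) := by
  rw [tendsto_pi_nhds]
  intro i
  rw [tendsto_iff_norm_sub_tendsto_zero]
  have h1 : Tendsto (fun n => √(K n / d i)) atTop (𝓝 0) := by
    have := (hK.div_const (d i)).sqrt
    rwa [zero_div, Real.sqrt_zero] at this
  exact squeeze_zero (fun n => norm_nonneg _) (fun n => abs_le_of_sum_mul_sq_le hd (hle n) i) h1

theorem exists_subset_closedBall_of_sum_mul_sq_le {ι : Type*} [Fintype ι] {d : ι → ℝ}
    (hd : ∀ i, 0 < d i) (a : ι → ℝ) (K : ℝ) :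
    ∃ C, ∀ v : ι → ℝ, ∑ i, d i * (v - a) i ^ 2 ≤ K → v ∈ Metric.closedBall a C := by
  refine ⟨∑ i, √(K / d i), fun v hv => ?_⟩
  rw [Metric.mem_closedBall, dist_pi_le_iff (Finset.sum_nonneg fun i _ => Real.sqrt_nonneg _)]
  exact fun i => (abs_le_of_sum_mul_sq_le hd hv i).trans
    (Finset.single_le_sum (f := fun i => √(K / d i)) (fun j _ => Real.sqrt_nonneg _)
      (Finset.mem_univ i))

/-- Since `D` dominates `½ P̃`, its norm controls a positive diagonal form. Boundedness and
convergence can then be checked coordinatewise, without eigenvalue estimates. -/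
theorem sum_le_two_mul_wsq_proxMetric
    (hQ : (proxMetric G M rho ω - (1 / 2 : ℝ) • diagI M P).PosDef) (v : XVec V M) :
    ∑ p, P p.1 * v p ^ 2 ≤ 2 * wsq (proxMetric G M rho ω) v := by
  have h1 := wsq_nonneg hQ v
  rw [wsq_sub_matrix, wsq_smul_matrix, diagI_eq_diagonal, wsq_diagonal] at h1
  linarith

theorem wsq_Gam_inv (hrho : ∀ i j, G.Adj i j → 0 < rho i j) (l : LVec G M) :
    wsq (Gam G M rho)⁻¹ l = ∑ p, (gam G rho M p)⁻¹ * l p ^ 2 := by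
  rw [Gam_inv_eq_diagonal G hrho, wsq_diagonal]

/-- A feasible point together with a multiplier for which it minimizes the Lagrangian. -/
structure IsSaddle (G : SimpleGraph V) [DecidableRel G.Adj]
    (g : V → EuclideanSpace ℝ (Fin M) → ℝ)
    (h : V → EuclideanSpace ℝ (Fin M) → EReal) (xs : XVec V M) (zs : ZVec G M)
    (l : LVec G M) : Prop where
  mem : xs ∈ domH h
  feasible : res G xs zs = 0
  transpose_B : (B G M)ᵀ *ᵥ l = 0
  le : ∀ u ∈ domH h, f g h xs ≤ f g h u + l ⬝ᵥ (A G M *ᵥ (u - xs))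

theorem IsSaddle.isPrimalDualOptimal {xs : XVec V M} {zs : ZVec G M} {l : LVec G M}
    (hs : IsSaddle G g h xs zs l) : IsPrimalDualOptimal G g h xs zs l := by
  refine isPrimalDualOptimal_of_forall_le hs.mem hs.feasible fun u hu z => ?_
  have h1 := hs.le u hu
  rwa [Matrix.mulVec_sub, dotProduct_sub, ← dotProduct_res_eq hs.transpose_B xs zs, hs.feasible,
    dotProduct_zero, sub_zero, ← dotProduct_res_eq hs.transpose_B u z] at h1

theorem exists_isSaddle (hG : G.Connected) (hA : Assumption g h P) :
    ∃ xs zs l, IsSaddle G g h xs zs l := by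
  obtain ⟨y, hy⟩ := hA.exists_opt
  have hopt := hy.isPrimalOptimal hG
  obtain ⟨l, hl⟩ := exists_multiplier hA hopt
  have hB := transpose_B_mulVec_eq_zero_of_forall_le hopt.1 hopt.2.1 hl
  refine ⟨_, _, l, hopt.1, hopt.2.1, hB, fun u hu => ?_⟩
  rw [Matrix.mulVec_sub, dotProduct_sub, ← dotProduct_res_eq hB (consensus V y) (fun q => y q.2),
    hopt.2.1, dotProduct_zero, sub_zero, ← dotProduct_res_eq hB u 0]
  exact hl u hu 0

/-- Minimality of the Lagrangian with `g` linearized at the saddle point, the form that can be added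
to the inequality of the algorithm. -/
theorem IsSaddle.variational_inequality (hA : Assumption g h P) {xs : XVec V M} {zs : ZVec G M}
    {l : LVec G M} (hs : IsSaddle G g h xs zs l) {u : XVec V M} (hu : u ∈ domH h) :
    0 ≤ hsum h u - hsum h xs
      + (gradStack g xs ⬝ᵥ (u - xs) + l ⬝ᵥ (A G M *ᵥ (u - xs))) := by
  have hd := (hasDerivAt_gsum_line hA xs (u - xs)).add
    ((hasDerivAt_id (0 : ℝ)).mul_const (l ⬝ᵥ (A G M *ᵥ (u - xs))))
  refine first_order_condition hA hs.mem hu (hd.congr_deriv (by rw [one_mul])) fun t ht => ?_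
  have h1 := hs.le _ ht
  rw [add_sub_cancel_left, Matrix.mulVec_smul, dotProduct_smul, f_eq, f_eq, smul_eq_mul] at h1
  simp only [Pi.add_apply, zero_smul, add_zero, id, zero_mul]
  linarith

/-- The weighted squared distance of the `r`-th iterate to a primal-dual pair. -/
noncomputable def distSq (G : SimpleGraph V) [DecidableRel G.Adj] (rho : V → V → ℝ) (ω : V → ℝ)
    (x : ℕ → XVec V M) (lam : ℕ → LVec G M) (xs : XVec V M) (l : LVec G M) (r : ℕ) : ℝ :=
  wsq (proxMetric G M rho ω) (x r - xs) + wsq (Gam G M rho)⁻¹ (lam r - l)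

/-- The inequality of the `x`-update is tested at the saddle point, and that of the saddle point at
the new iterate. Their sum leaves a gradient difference between the old iterate and the saddle
point; the three-point inequality bounds it by a quarter of the `P̃`-step, hence the loss of only `½
P̃`. -/
theorem IsPGC.fejer (hA : Assumption g h P) (hrho : ∀ i j, G.Adj i j → 0 < rho i j)
    (hw : IsPGC G rho ω g h x z lam) {xs : XVec V M} {zs : ZVec G M} {l : LVec G M}
    (hs : IsSaddle G g h xs zs l) {r : ℕ} (hx : x r ∈ domH h) :
    distSq G rho ω x lam xs l (r + 1)
        + (wsq (proxMetric G M rho ω - (1 / 2 : ℝ) • diagI M P) (x (r + 1) - x r)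
          + wsq (Gam G M rho)⁻¹ (lam (r + 1) - lam r))
      ≤ distSq G rho ω x lam xs l r := by
  have h1 := hw.variational_inequality hA hrho r hs.mem
  have h2 := hs.variational_inequality hA (hw.x_mem r)
  have h3 := gradStack_three_point hA hx hs.mem (hw.x_mem r)
  have h4 := hw.dotProduct_res hrho r l
  rw [hw.mulVec_dotProduct_sub hrho r hs.feasible,
    dotProduct_mulVec_sub_sub (proxMetric_transpose G rho ω)] at h1
  rw [Matrix.mulVec_sub, dotProduct_sub l, ← dotProduct_res_eq hs.transpose_B xs zs, hs.feasible,
    dotProduct_zero, sub_zero,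
    ← dotProduct_res_eq hs.transpose_B (x (r + 1)) (z (r + 1))] at h2
  rw [sub_dotProduct] at h3 h4
  have h5 : gradStack g (x r) ⬝ᵥ (xs - x (r + 1)) = -(gradStack g (x r) ⬝ᵥ (x (r + 1) - xs)) := by
    rw [← dotProduct_neg, neg_sub]
  rw [h5] at h1
  rw [distSq, distSq, wsq_sub_matrix, wsq_smul_matrix]
  linarith

theorem distSq_nonneg (hrho : ∀ i j, G.Adj i j → 0 < rho i j)
    (hD : (proxMetric G M rho ω).PosDef) (xs : XVec V M) (l : LVec G M) (r : ℕ) :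
    0 ≤ distSq G rho ω x lam xs l r :=
  add_nonneg (wsq_nonneg hD _) (wsq_nonneg (posDef_Gam_inv hrho) _)

theorem exists_tendsto_of_antitone_of_nonneg {W : ℕ → ℝ} (hW : Antitone W) (h0 : ∀ n, 0 ≤ W n) :
    ∃ L, Tendsto W atTop (𝓝 L) :=
  ⟨_, tendsto_atTop_ciInf hW ⟨0, by rintro _ ⟨n, rfl⟩; exact h0 n⟩⟩

/-- The index is shifted because the initial point may lie outside the domain, where the Lipschitz
bound says nothing. -/
theorem IsPGC.antitone_distSq (hA : Assumption g h P) (hrho : ∀ i j, G.Adj i j → 0 < rho i j)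
    (hw : IsPGC G rho ω g h x z lam)
    (hQ : (proxMetric G M rho ω - (1 / 2 : ℝ) • diagI M P).PosDef)
    {xs : XVec V M} {zs : ZVec G M} {l : LVec G M} (hs : IsSaddle G g h xs zs l) :
    Antitone fun n => distSq G rho ω x lam xs l (n + 1) :=
  antitone_nat_of_succ_le fun n => by
    have h1 := hw.fejer hA hrho hs (hw.x_mem n)
    have h2 := wsq_nonneg hQ (x (n + 1 + 1) - x (n + 1))
    have h3 := wsq_nonneg (posDef_Gam_inv (M := M) hrho) (lam (n + 1 + 1) - lam (n + 1))
    linarith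

theorem IsPGC.tendsto_steps (hA : Assumption g h P) (hrho : ∀ i j, G.Adj i j → 0 < rho i j)
    (hw : IsPGC G rho ω g h x z lam)
    (hQ : (proxMetric G M rho ω - (1 / 2 : ℝ) • diagI M P).PosDef)
    (hD : (proxMetric G M rho ω).PosDef)
    {xs : XVec V M} {zs : ZVec G M} {l : LVec G M} (hs : IsSaddle G g h xs zs l) :
    Tendsto (fun n => wsq (proxMetric G M rho ω - (1 / 2 : ℝ) • diagI M P)
        (x (n + 2) - x (n + 1))) atTop (𝓝 0) ∧
      Tendsto (fun n => wsq (Gam G M rho)⁻¹ (lam (n + 2) - lam (n + 1))) atTop (𝓝 0) := by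
  obtain ⟨L, hL⟩ := exists_tendsto_of_antitone_of_nonneg (hw.antitone_distSq hA hrho hQ hs)
    fun n => distSq_nonneg hrho hD _ _ _
  have hdiff : Tendsto (fun n => distSq G rho ω x lam xs l (n + 1)
      - distSq G rho ω x lam xs l (n + 1 + 1)) atTop (𝓝 0) := by
    have := hL.sub (hL.comp (tendsto_add_atTop_nat 1))
    rwa [sub_self] at this
  have hn1 := fun n => wsq_nonneg hQ (x (n + 2) - x (n + 1))
  have hn2 := fun n => wsq_nonneg (posDef_Gam_inv (M := M) hrho) (lam (n + 2) - lam (n + 1))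
  have hf := fun n => hw.fejer hA hrho hs (hw.x_mem n)
  exact ⟨squeeze_zero hn1 (fun n => by linarith [hn2 n, hf n]) hdiff,
    squeeze_zero hn2 (fun n => by linarith [hn1 n, hf n]) hdiff⟩

/-- Passing to the limit in the proximal step along a subsequence. -/
theorem IsPGC.le_of_tendsto_subseq (hA : Assumption g h P)
    (hrho : ∀ i j, G.Adj i j → 0 < rho i j) (hw : IsPGC G rho ω g h x z lam) {φ : ℕ → ℕ}
    {a : XVec V M} {c : LVec G M} (hx₁ : Tendsto (fun n => x (φ n + 1)) atTop (𝓝 a))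
    (hx₂ : Tendsto (fun n => x (φ n + 2)) atTop (𝓝 a))
    (hl : Tendsto (fun n => lam (φ n + 2)) atTop (𝓝 c)) {u : XVec V M} (hu : u ∈ domH h) :
    a ∈ domH h ∧ f g h a ≤ f g h u + c ⬝ᵥ (A G M *ᵥ (u - a)) := by
  have hstep := hx₂.sub hx₁
  have hdir := hx₂.const_sub u
  -- The continuous part `g` is moved to the bounding side, so that only `h` needs lower
  -- semicontinuity.
  have hlim := ((((tendsto_dotProduct hl (tendsto_mulVec (A G M) hdir)).const_add (f g h u)).add
    (tendsto_dotProduct hstep (tendsto_mulVec (proxMetric G M rho ω) hdir))).add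
    ((tendsto_wsq (diagI M P) hstep).const_mul (1 / 2))).sub
    (((continuous_gsum hA).tendsto a).comp hx₂)
  rw [sub_self, zero_dotProduct, wsq_zero, mul_zero, add_zero, add_zero] at hlim
  have h1 := mem_domH_and_hsum_le_of_tendsto hA hx₂ hlim (fun n => hw.x_mem _) fun n => by
    have h2 := hw.objective_le hA hrho (r := φ n + 1) (hw.x_mem _) hu
    rw [f_eq] at h2
    exact le_sub_iff_add_le'.2 h2
  refine ⟨h1.1, ?_⟩
  rw [f_eq g h a]
  linarith [h1.2]

/-- Every bounded run has a saddle point among its cluster points. -/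
theorem IsPGC.exists_cluster_isSaddle (hG : G.Connected) (hA : Assumption g h P)
    (hrho : ∀ i j, G.Adj i j → 0 < rho i j)
    (hw : IsPGC G rho ω g h x z lam)
    (hQ : (proxMetric G M rho ω - (1 / 2 : ℝ) • diagI M P).PosDef)
    (hD : (proxMetric G M rho ω).PosDef) :
    ∃ (a : XVec V M) (c : LVec G M) (φ : ℕ → ℕ),
      IsSaddle G g h a ((1 / 2 : ℝ) • ((Mplus G M)ᵀ *ᵥ a)) c ∧ StrictMono φ ∧
      Tendsto (fun n => x (φ n + 2)) atTop (𝓝 a) ∧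
      Tendsto (fun n => lam (φ n + 2)) atTop (𝓝 c) := by
  obtain ⟨xs, zs, l, hs⟩ := exists_isSaddle (G := G) hG hA
  have hanti := hw.antitone_distSq hA hrho hQ hs
  obtain ⟨hxstep, hlstep⟩ := hw.tendsto_steps hA hrho hQ hD hs
  have hγ : ∀ p, 0 < (gam G rho M p)⁻¹ := fun p => inv_pos.2 (gam_pos G hrho p)
  have hle : ∀ n, distSq G rho ω x lam xs l (n + 1) ≤ distSq G rho ω x lam xs l 1 :=
    fun n => hanti (Nat.zero_le n)
  obtain ⟨C₁, hC₁⟩ := exists_subset_closedBall_of_sum_mul_sq_le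
    (fun p : V × Fin M => hA.P_pos p.1) xs (2 * distSq G rho ω x lam xs l 1)
  obtain ⟨C₂, hC₂⟩ := exists_subset_closedBall_of_sum_mul_sq_le hγ l
    (distSq G rho ω x lam xs l 1)
  have hxb : ∀ n, x (n + 1) ∈ Metric.closedBall xs C₁ := fun n => hC₁ _ <| by
    have h1 := sum_le_two_mul_wsq_proxMetric hQ (x (n + 1) - xs)
    have h2 := hle n
    have h3 := wsq_nonneg (posDef_Gam_inv (M := M) hrho) (lam (n + 1) - l)
    rw [distSq] at h2
    linarith
  have hlb : ∀ n, lam (n + 1) ∈ Metric.closedBall l C₂ := fun n => hC₂ _ <| by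
    have h2 := hle n
    have h3 := wsq_nonneg hD (x (n + 1) - xs)
    rw [distSq, wsq_Gam_inv hrho] at h2
    linarith
  -- One subsequence is chosen for two consecutive primal iterates and the multiplier; vanishing
  -- steps then identify the two primal limits.
  obtain ⟨⟨a, b, c⟩, -, φ, hφ, hlim⟩ :=
    ((isCompact_closedBall xs C₁).prod
      ((isCompact_closedBall xs C₁).prod (isCompact_closedBall l C₂))).tendsto_subseq
      (x := fun n => (x (n + 1), x (n + 2), lam (n + 2)))
      (fun n => ⟨hxb n, hxb (n + 1), hlb (n + 1)⟩)
  have hla : Tendsto (fun n => x (φ n + 1)) atTop (𝓝 a) := (continuous_fst.tendsto _).comp hlim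
  have hlb' : Tendsto (fun n => x (φ n + 2)) atTop (𝓝 b) :=
    ((continuous_fst.comp continuous_snd).tendsto _).comp hlim
  have hlc : Tendsto (fun n => lam (φ n + 2)) atTop (𝓝 c) :=
    ((continuous_snd.comp continuous_snd).tendsto _).comp hlim
  have hba : b = a := by
    have h1 := tendsto_wsq (proxMetric G M rho ω - (1 / 2 : ℝ) • diagI M P) (hlb'.sub hla)
    have h2 := tendsto_nhds_unique h1 (hxstep.comp hφ.tendsto_atTop)
    by_contra hne
    exact (wsq_pos hQ (sub_ne_zero.2 hne)).ne' h2
  subst hba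
  -- The increment of the multiplier is `Γ` times the residual, so vanishing multiplier steps make
  -- the limit feasible.
  have hfeas : res G b ((1 / 2 : ℝ) • ((Mplus G M)ᵀ *ᵥ b)) = 0 := by
    have h1 : Tendsto (fun n => wsq (Gam G M rho)⁻¹ (lam (φ n + 2) - lam (φ n + 1))) atTop
        (𝓝 (wsq (Gam G M rho)⁻¹ (Gam G M rho *ᵥ
          res G b ((1 / 2 : ℝ) • ((Mplus G M)ᵀ *ᵥ b))))) := by
      have h2 := tendsto_wsq (Gam G M rho)⁻¹ (tendsto_mulVec (Gam G M rho)
        ((tendsto_mulVec (A G M) hlb').add (tendsto_mulVec (B G M)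
          ((tendsto_mulVec (Mplus G M)ᵀ hlb').const_smul (1 / 2 : ℝ)))))
      refine h2.congr fun n => ?_
      rw [hw.lam_step (φ n + 1), add_sub_cancel_left, hw.z_eq hrho, res]
    have h3 := tendsto_nhds_unique h1 (hlstep.comp hφ.tendsto_atTop)
    have h4 : Gam G M rho *ᵥ res G b ((1 / 2 : ℝ) • ((Mplus G M)ᵀ *ᵥ b)) = 0 := by
      by_contra hne
      exact (wsq_pos (posDef_Gam_inv hrho) hne).ne' h3
    rw [← Matrix.one_mulVec (res G b _), ← Gam_inv_mul hrho, ← Matrix.mulVec_mulVec, h4,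
      Matrix.mulVec_zero]
  have hBc : (B G M)ᵀ *ᵥ c = 0 := by
    have h1 := tendsto_mulVec (B G M)ᵀ hlc
    refine tendsto_nhds_unique h1 (tendsto_const_nhds.congr fun n => ?_)
    exact (hw.transpose_B_mulVec_lam hrho _).symm
  exact ⟨b, c, φ, ⟨(hw.le_of_tendsto_subseq hA hrho hla hlb' hlc hs.mem).1, hfeas, hBc,
    fun u hu => (hw.le_of_tendsto_subseq hA hrho hla hlb' hlc hu).2⟩, hφ, hlb', hlc⟩

theorem IsPGC.tendsto_isPrimalDualOptimal (hG : G.Connected) (hA : Assumption g h P)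
    (hrho : ∀ i j, G.Adj i j → 0 < rho i j)
    (hw : IsPGC G rho ω g h x z lam)
    (hQ : (proxMetric G M rho ω - (1 / 2 : ℝ) • diagI M P).PosDef) :
    ∃ (xs : XVec V M) (zs : ZVec G M) (lams : LVec G M),
      IsPrimalDualOptimal G g h xs zs lams ∧ Tendsto x atTop (𝓝 xs) ∧
      Tendsto z atTop (𝓝 zs) ∧ Tendsto lam atTop (𝓝 lams) := by
  have hD : (proxMetric G M rho ω).PosDef := by
    have := hQ.add ((posDef_diagI (M := M) hA.P_pos).smul (by norm_num : (0 : ℝ) < 1 / 2))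
    rwa [sub_add_cancel] at this
  obtain ⟨a, c, φ, hs, hφ, hxa, hlc⟩ := hw.exists_cluster_isSaddle hG hA hrho hQ hD
  obtain ⟨L, hL⟩ := exists_tendsto_of_antitone_of_nonneg (hw.antitone_distSq hA hrho hQ hs)
    fun n => distSq_nonneg hrho hD _ _ _
  -- The cluster point is itself a saddle point, so the distance to it is monotone; it vanishes
  -- along a subsequence, hence altogether.
  have hL0 : L = 0 := by
    have h1 := hL.comp ((tendsto_add_atTop_nat 1).comp hφ.tendsto_atTop)
    have h2 := (tendsto_wsq (proxMetric G M rho ω) (hxa.sub_const a)).add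
      (tendsto_wsq (Gam G M rho)⁻¹ (hlc.sub_const c))
    rw [sub_self, sub_self, wsq_zero, wsq_zero, add_zero] at h2
    exact tendsto_nhds_unique h1 h2
  rw [hL0] at hL
  have hx : Tendsto x atTop (𝓝 a) := by
    rw [← tendsto_add_atTop_iff_nat 1]
    refine tendsto_of_sum_mul_sq_le (fun p : V × Fin M => hA.P_pos p.1)
      (K := fun n => 2 * distSq G rho ω x lam a c (n + 1)) (fun n => ?_)
      (by simpa using hL.const_mul 2)
    have h1 := sum_le_two_mul_wsq_proxMetric hQ (x (n + 1) - a)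
    have h3 := wsq_nonneg (posDef_Gam_inv (M := M) hrho) (lam (n + 1) - c)
    rw [distSq]
    linarith
  have hl : Tendsto lam atTop (𝓝 c) := by
    rw [← tendsto_add_atTop_iff_nat 1]
    refine tendsto_of_sum_mul_sq_le (fun p => inv_pos.2 (gam_pos (M := M) G hrho p))
      (fun n => ?_) hL
    have h3 := wsq_nonneg hD (x (n + 1) - a)
    rw [distSq, ← wsq_Gam_inv hrho]
    linarith
  refine ⟨a, _, c, hs.isPrimalDualOptimal, hx, ?_, hl⟩
  have hz : z = fun n => (1 / 2 : ℝ) • ((Mplus G M)ᵀ *ᵥ x n) := funext fun n => hw.z_eq hrho n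
  rw [hz]
  exact (tendsto_mulVec (Mplus G M)ᵀ hx).const_smul (1 / 2 : ℝ)

end Convergence

end PGC

theorem theorem4p1 {V : Type*} [Fintype V] [DecidableEq V] (G : SimpleGraph V)
    [DecidableRel G.Adj] (hG : G.Connected) (M : ℕ)
    (g : V → EuclideanSpace ℝ (Fin M) → ℝ) (h : V → EuclideanSpace ℝ (Fin M) → EReal)
    (P : V → ℝ) (hA : PGC.Assumption g h P)
    (rho : V → V → ℝ) (hrho : ∀ i j, G.Adj i j → 0 < rho i j)
    (ω : V → ℝ) (hω : ∀ i, 0 ≤ ω i)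
    (x : ℕ → PGC.XVec V M) (z : ℕ → PGC.ZVec G M) (lam : ℕ → PGC.LVec G M)
    (hw : PGC.IsPGC G rho ω g h x z lam) :
    -- the identity between the two forms of the stepsize matrix
    ((2 : ℝ) • PGC.diagI M ω + PGC.Mplus G M * PGC.XiI G M rho * (PGC.Mplus G M)ᵀ
      = PGC.Ups G M rho ω * (PGC.W G rho ω ⊗ₖ (1 : Matrix (Fin M) (Fin M) ℝ))
        + PGC.Ups G M rho ω) ∧
    -- part (a)
    (((2 : ℝ) • PGC.diagI M ω + PGC.Mplus G M * PGC.XiI G M rho * (PGC.Mplus G M)ᵀ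
        - PGC.diagI M P).PosDef →
      ∃ (xs : PGC.XVec V M) (zs : PGC.ZVec G M) (lams : PGC.LVec G M),
        PGC.IsPrimalDualOptimal G g h xs zs lams ∧
        Filter.Tendsto x Filter.atTop (nhds xs) ∧
        Filter.Tendsto z Filter.atTop (nhds zs) ∧
        Filter.Tendsto lam Filter.atTop (nhds lams)) ∧
    -- part (b)
    (Bornology.IsBounded (PGC.domH h) →
      ((2 : ℝ) • PGC.diagI M ω + PGC.Mplus G M * PGC.XiI G M rho * (PGC.Mplus G M)ᵀ
        - (2 : ℝ) • PGC.diagI M P).PosDef →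
      x 0 ∈ PGC.domH h →
      ∀ (xs : PGC.XVec V M) (zs : PGC.ZVec G M), PGC.IsPrimalOptimal G g h xs zs →
      ∀ R : ℝ, 0 < R → ∀ r : ℕ, 0 < r →
        PGC.avg x r ∈ PGC.domH h ∧
        PGC.f g h (PGC.avg x r) - PGC.f g h xs
            + R * PGC.euclNorm (PGC.res G (PGC.avg x r) (PGC.avg z r))
          ≤ 1 / (2 * (r : ℝ)) * (PGC.dz G rho h ^ 2 + PGC.dlam G rho (lam 0) R ^ 2
              + (⨆ i, ω i) * PGC.dx h ^ 2)) := by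
  have hstep := PGC.two_smul_proxMetric G (M := M) rho ω
  refine ⟨PGC.stepsize_identity G hrho hω, fun hpos => ?_,
    fun hb hpos hx0 xs zs hopt R hR r hr => ⟨?_, ?_⟩⟩
  · refine hw.tendsto_isPrimalDualOptimal hG hA hrho ?_
    -- Halving passes from the matrix of the statement to the proximal metric: `D ≻ ½ P̃` here, `D ≻
    -- P̃` for the rate.
    have h1 := hpos.smul (by norm_num : (0 : ℝ) < 1 / 2)
    rw [hstep, smul_sub, smul_smul] at h1
    norm_num at h1
    simpa using h1
  · refine PGC.avg_mem (PGC.convex_domH hA) hr fun t ht => ?_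
    obtain ⟨k, rfl⟩ := Nat.exists_eq_add_of_le' (Finset.mem_Icc.1 ht).1
    exact hw.x_mem k
  · have := hG.nonempty
    refine hw.ergodic_rate hA hrho hω hb ?_ hx0 hopt.1 hopt.2.1 hR hr
    have h1 := hpos.smul (by norm_num : (0 : ℝ) < 1 / 2)
    rw [hstep, ← smul_sub, smul_smul] at h1
    norm_num at h1
    exact h1
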